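/- **Setting.** Consider $m$ resources and $n$ products $\mathcal J=\{1,\dots,n\}$, a horizon $T>0$, an arrival rate $\lambda>0$, a temperature $\gamma>0$, an initial inventory $c\in\mathbb N^m$, prices $p\in\mathbb R^n$, and a consumption matrix $A\in\mathbb N^{m\times n}$ whose columns $A^j$ are all nonzero. Customers arrive according to a Poisson process of rate $\lambda$; a customer who is offered the assortment $S\subseteq\mathcal J$ buys product $j$ with probability $P_j(S)$ and nothing with probability $P_0(S)$, where $P_j(S)\ge 0$, $P_j(S)=0$ for $j\in\mathcal J\setminus S$, and $\sum_{j\in S\cup\{0\}}P_j(S)=1$. The states are the inventory levels $x\in\mathcal X=\prod_{i=1}^m\{0,\dots,c_i\}$, and the feasible assortments at $x$ are $\mathcal A(x)=\{S\subseteq\mathcal J: A^j\le x\text{ for all }j\in S\}$. Put $r(S)=\lambda\sum_j p_jP_j(S)$, $q(y\mid x,S)=\sum_{j:\,A^j=x-y}\lambda P_j(S)$ for $y\ne x$, $q(x\mid x,S)=-\lambda(1-P_0(S))$, and $$H(t,x,S,v)=r(S)+\sum_{y\in\mathcal X}v(t,y)\,q(y\mid x,S).$$ An admissible policy $\pi\in\Pi$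 assigns to each $(t,x)\in[0,T]\times\mathcal X$ a probability distribution $\pi(\cdot\mid t,x)$ on the subsets of $\mathcal J$ that is supported on $\mathcal A(x)$, with $t\mapsto\pi(S\mid t,x)$ continuous (hence measurable) on $[0,T]$. Under $\pi$, a customer arriving at time $\tau$ is offered an assortment drawn (independently of everything else) from $\pi(\cdot\mid\tau,X_{\tau-})$, then chooses from it according to the choice probabilities; buying $j$ changes the inventory level from $X_{\tau-}$ to $X_{\tau-}-A^j$. Let $N_s$ be the vector of numbers of products sold up to time $s$, and let $\mathcal H(\pi(\cdot\mid s,x))=-\sum_{S\in\mathcal A(x)}\pi(S\mid s,x)\log\pi(S\mid s,x)$, with $0\log 0=0$. The entropy-regularized value of $\pi$ and the optimal one are $$J(t,x;\pi)=\mathbb E\Big[\int_{(t,T]}p^\top dN_s+\gamma\int_t^T\mathcal H(\pi(\cdot\mid s,X_{s-}))\,ds\Big],\qquad J^*(t,x)=\sup_{\pi\in\Pi}J(t,x;\pi),$$ where the expectation refers to the process started at time $t$ in the state $x$. A policy $\pi\in\Pi$ is optimal if $J(t,x;\pi)=J^*(t,x)$ for all $(t,x)\in[0,T]\times\mathcal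 X$. Let $C^{1,0}$ be the set of functions $v:[0,T]\times\mathcal X\to\mathbb R$ such that $v(\cdot,x)$ is continuously differentiable on $[0,T]$ for every $x$. **Statement.** The rewards in $J(t,x;\pi)$ are integrable for all $\pi\in\Pi$, and the supremum $J^*(t,x)$ is finite, for all $(t,x)\in[0,T]\times\mathcal X$. The exploratory HJB equation $$\frac{\partial v}{\partial t}(t,x)+\sup_{\pi\in\Pi}\sum_{S\in\mathcal A(x)}\big[H(t,x,S,v)-\gamma\log\pi(S\mid t,x)\big]\pi(S\mid t,x)=0\quad\text{on }[0,T)\times\mathcal X,\qquad v(T,\cdot)=0,$$ has a solution $v\in C^{1,0}$, and every such solution equals $J^*$ on $[0,T]\times\mathcal X$. The policy $$\pi^*(S\mid t,x)=\frac{\exp\{H(t,x,S,J^*)/\gamma\}}{\sum_{\bar S\in\mathcal A(x)}\exp\{H(t,x,\bar S,J^*)/\gamma\}}\quad(S\in\mathcal A(x)),\qquad \pi^*(S\mid t,x)=0\quad(S\notin\mathcal A(x)),$$ is admissible and optimal, and it is the only optimal policy on $[0,T]\times\mathcal X$. -/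

import Mathlib

open MeasureTheory ProbabilityTheory Set

noncomputable section

/-- Inverse-transform sampling from a list of outcomes with weights `w`: the unit interval is cut
into consecutive half-open cells of lengths `w a`, and the outcome whose cell contains `u` is
returned.  The default is returned only if `u` is not below the total weight of the list. -/
def sampleList {α : Type*} [Inhabited α] (w : α → ℝ) : List α → ℝ → α
  | [], _ => default
  | a :: l, u => if u < w a then a else sampleList w l (u - w a)

/-- If `w` is a probability vector on `α` and `u` is uniform on `[0, 1]`, then `sample w u` has
distribution `w`. -/
def sample {α : Type*} [Fintype α] [Inhabited α] (w : α → ℝ) (u : ℝ) : α :=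
  sampleList w Finset.univ.toList u

/-- The data of a choice-based network revenue management problem with `m` resources and `n`
products. -/
structure NRM (m n : ℕ) where
  /-- length of the selling horizon -/
  T : ℝ
  T_pos : 0 < T
  /-- arrival rate of the customers -/
  rate : ℝ
  rate_pos : 0 < rate
  /-- temperature -/
  temp : ℝ
  temp_pos : 0 < temp
  /-- initial inventory -/
  c : Fin m → ℕ
  /-- consumption matrix: `A i j` units of resource `i` are used by one unit of product `j` -/
  A : Matrix (Fin m) (Fin n) ℕ
  /-- every product uses some resource -/
  A_ne_zero : ∀ j, ∃ i, A i j ≠ 0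
  /-- prices -/
  price : Fin n → ℝ
  /-- choice probabilities: `choiceProb S (some j)` is the probability that a customer who is
  offered `S` buys product `j`, and `choiceProb S none` that of no purchase -/
  choiceProb : Finset (Fin n) → Option (Fin n) → ℝ
  choiceProb_nonneg : ∀ S o, 0 ≤ choiceProb S o
  choiceProb_notMem : ∀ S j, j ∉ S → choiceProb S (some j) = 0
  choiceProb_sum : ∀ S, ∑ o, choiceProb S o = 1

namespace NRM

variable {m n : ℕ} (M : NRM m n)

/-- The state space `{0, …, c₁} × ⋯ × {0, …, c_m}` of inventory levels. -/
abbrev State : Type := (i : Fin m) → Fin (M.c i + 1)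

/-- The feasible assortments at the inventory level `x`: those all of whose products can be sold
at `x`. -/
def feasible (x : M.State) : Finset (Finset (Fin n)) :=
  Finset.univ.filter fun S => ∀ j ∈ S, ∀ i, M.A i j ≤ (x i : ℕ)

/-- The expected revenue rate of the assortment `S`. -/
def revenueRate (S : Finset (Fin n)) : ℝ :=
  M.rate * ∑ j, M.price j * M.choiceProb S (some j)

/-- The transition rate from `x` to `y` when `S` is offered.  The sum is over the products `j`
whose consumption vector is `x - y`. -/
def transitionRate (y x : M.State) (S : Finset (Fin n)) : ℝ :=
  if y = x then -(M.rate * (1 - M.choiceProb S none))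
  else ∑ j ∈ Finset.univ.filter (fun j => ∀ i, (y i : ℕ) + M.A i j = (x i : ℕ)),
    M.rate * M.choiceProb S (some j)

/-- The Hamiltonian. -/
def hamiltonian (v : ℝ → M.State → ℝ) (t : ℝ) (x : M.State) (S : Finset (Fin n)) : ℝ :=
  M.revenueRate S + ∑ y, v t y * M.transitionRate y x S

/-- Randomized policies assign to a time, a state and an assortment the probability of offering
the assortment.  Only times in `[0, T]` matter. -/
abbrev Policy : Type := ℝ → M.State → Finset (Fin n) → ℝ

/-- Randomized Markov policies. -/
structure IsMarkovPolicy (π : M.Policy) : Prop where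
  measurable : ∀ x S, Measurable fun t : Icc (0 : ℝ) M.T => π t x S
  nonneg : ∀ t ∈ Icc 0 M.T, ∀ x S, 0 ≤ π t x S
  sum_eq_one : ∀ t ∈ Icc 0 M.T, ∀ x, ∑ S, π t x S = 1

/-- Admissible randomized Markov policies offer feasible assortments only and are continuous in
time. -/
structure IsAdmissible (π : M.Policy) : Prop extends M.IsMarkovPolicy π where
  eq_zero : ∀ t ∈ Icc 0 M.T, ∀ x, ∀ S ∉ M.feasible x, π t x S = 0
  continuousOn : ∀ x S, ContinuousOn (fun t => π t x S) (Icc 0 M.T)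

/-- The entropy of the distribution of the assortment that `π` offers at `(t, x)`. -/
def entropy (π : M.Policy) (t : ℝ) (x : M.State) : ℝ :=
  -∑ S ∈ M.feasible x, π t x S * Real.log (π t x S)

/-! ### The sample state process and the value functions -/

/-- The noise attached to one customer: the time since the previous arrival, and one uniform
random variable each for the offered assortment and for the choice of the customer. -/
abbrev Noise : Type := ℝ × unitInterval × unitInterval

/-- Interarrival times are exponential, so that customers arrive according to a Poisson process. -/
def noiseLaw : Measure Noise :=
  (expMeasure M.rate).prod ((volume : Measure unitInterval).prod (volume : Measure unitInterval))

instance : IsProbabilityMeasure M.noiseLaw := by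
  have := isProbabilityMeasure_expMeasure M.rate_pos
  unfold noiseLaw
  infer_instance

/-- The customers' noises are independent and identically distributed. -/
def law : Measure (ℕ → Noise) := Measure.infinitePi fun _ => M.noiseLaw

/-- The time of the `k`-th arrival after time `t` (`k = 0, 1, …`). -/
def arrival (t : ℝ) (ω : ℕ → Noise) (k : ℕ) : ℝ :=
  t + ∑ i ∈ Finset.range (k + 1), (ω i).1

/-- The inventory level after a customer who met the inventory level `x` has bought `o`.  The
subtraction is never truncated when a feasible assortment was offered. -/
def sell (x : M.State) : Option (Fin n) → M.State
  | none => x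
  | some j => fun i => ⟨(x i : ℕ) - M.A i j, by have := (x i).isLt; omega⟩

/-- What a customer buys who arrives at time `τ`, meets the inventory level `x` and has the noise
`z`: an assortment `S` is drawn from `π(· | τ, x)` and then a choice from the choice probabilities
of `S`. -/
def purchase (π : M.Policy) (τ : ℝ) (x : M.State) (z : Noise) : Option (Fin n) :=
  sample (M.choiceProb (sample (π τ x) (z.2.1 : ℝ))) (z.2.2 : ℝ)

/-- What the `k`-th customer after time `t` buys when meeting the inventory level `y`; nothing
unless the customer arrives in `(t, T]`. -/
def outcome (π : M.Policy) (t : ℝ) (ω : ℕ → Noise) (k : ℕ) (y : M.State) : Option (Fin n) :=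
  open scoped Classical in
  if arrival t ω k ∈ Ioc t M.T then M.purchase π (arrival t ω k) y (ω k) else none

/-- The inventory level that the `k`-th customer after time `t` meets, for the process that starts
at time `t` in the state `x`. -/
def preState (π : M.Policy) (t : ℝ) (x : M.State) (ω : ℕ → Noise) : ℕ → M.State
  | 0 => x
  | k + 1 => M.sell (preState π t x ω k) (M.outcome π t ω k (preState π t x ω k))

/-- What the `k`-th customer after time `t` buys, for the process that starts at time `t` in the
state `x`. -/
def sale (π : M.Policy) (t : ℝ) (x : M.State) (ω : ℕ → Noise) (k : ℕ) : Option (Fin n) :=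
  M.outcome π t ω k (M.preState π t x ω k)

/-- The left limit `X_{s-}` at the time `s ∈ (t, T]` of the state process that starts at time `t`
in the state `x`: the inventory level met by the first customer who arrives at or after `s`. -/
def leftState (π : M.Policy) (t : ℝ) (x : M.State) (ω : ℕ → Noise) (s : ℝ) : M.State :=
  M.preState π t x ω (sInf {k | s ≤ arrival t ω k})

/-- The revenue from a purchase. -/
def revenue (o : Option (Fin n)) : ℝ := o.elim 0 M.price

/-- The entropy-regularized reward `∫_{(t, T]} pᵀ dN + γ ∫_t^T ℋ(π(· | s, X_{s-})) ds` along a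
path.  Almost surely only finitely many terms of the first sum are nonzero. -/
def reward (π : M.Policy) (t : ℝ) (x : M.State) (ω : ℕ → Noise) : ℝ :=
  (∑' k, M.revenue (M.sale π t x ω k)) +
    M.temp * ∫ s in t..M.T, M.entropy π s (M.leftState π t x ω s)

/-- The entropy-regularized value `J(t, x; π)`. -/
def value (π : M.Policy) (t : ℝ) (x : M.State) : ℝ :=
  ∫ ω, M.reward π t x ω ∂M.law

/-- The optimal entropy-regularized value `J*(t, x)`, the supremum over the admissible policies. -/
def optValue (t : ℝ) (x : M.State) : ℝ :=
  ⨆ π : {π : M.Policy // M.IsAdmissible π}, M.value π.1 t x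

/-- A policy is optimal if it is admissible and attains `J*(t, x)` for all times and states. -/
def IsOptimal (π : M.Policy) : Prop :=
  M.IsAdmissible π ∧ ∀ t ∈ Icc 0 M.T, ∀ x, M.value π t x = M.optValue t x

/-! ### The exploratory Hamilton–Jacobi–Bellman equation -/

/-- The class `C^{1,0}([0, T] × 𝒳)`. -/
def IsC10 (v : ℝ → M.State → ℝ) : Prop :=
  ∀ x, ContDiffOn ℝ 1 (fun t => v t x) (Icc 0 M.T)

/-- The exploratory HJB equation: at all times `t ∈ [0, T)` the sum of `∂v/∂t` and of the supremum
over the admissible policies of `∑_S (H(t, x, S, v) - γ log π(S | t, x)) π(S | t, x)` vanishes, and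
`v(T, ·) = 0`. -/
structure SolvesHJB (v : ℝ → M.State → ℝ) : Prop where
  isLUB : ∀ t ∈ Ico 0 M.T, ∀ x,
    IsLUB {a : ℝ | ∃ π : M.Policy, M.IsAdmissible π ∧
      a = ∑ S ∈ M.feasible x,
        (M.hamiltonian v t x S - M.temp * Real.log (π t x S)) * π t x S}
      (-derivWithin (fun s => v s x) (Icc 0 M.T) t)
  terminal : ∀ x, v M.T x = 0

/-- The Boltzmann policy `π(S | t, x) ∝ exp (H(t, x, S, v) / γ)` on the feasible assortments. -/
def boltzmann (v : ℝ → M.State → ℝ) : M.Policy := fun t x S =>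
  if S ∈ M.feasible x then
    Real.exp (M.hamiltonian v t x S / M.temp) /
      ∑ S' ∈ M.feasible x, Real.exp (M.hamiltonian v t x S' / M.temp)
  else 0

end NRM

end

/-!
The proof compares the value of an arbitrary policy with a solution of the HJB equation on the level
of the first arrival, so that no theory of jump processes is needed.

Every sale uses up at least one unit of inventory, hence the reward is bounded on every path
(`exists_abs_reward_le`) and integrable.  Splitting off the noise of the first customer
(`measurePreserving_seqCons`, `reward_seqCons`) gives the renewal equation for the value of a
policy: it is the expectation of the running reward up to the first arrival, plus the revenue from that
arrival and the value at the time and state thereafter (`value_eq_integral`).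

By the Gibbs variational identity (`sum_add_klFun_eq_log_sum_exp`) the supremum in the HJB equation
is the free energy `γ log ∑ exp (H / γ)`, attained by the Boltzmann policy alone, and any policy `π`
falls short of it by `gap`, the temperature times a relative entropy.  A solution `w` of the HJB
equation therefore solves the linear backward equation of `π` with the running reward increased by
`gap`, and so satisfies the corresponding renewal equation (`eq_integral_arrivalStep`).
Subtracting, `d = w - J(·; π)` satisfies the renewal equation whose only reward is the running
reward `gap ≥ 0` (`sub_value_eq`).  As the next customer fails to arrive before `T` with probability at
least `exp (-λ T)`, this equation is a contraction: `d ≥ 0`, with equality everywhere if `gap`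
vanishes (`nonneg_of_renewal`).  Conversely, if `d` vanishes then so does the integral of `gap`, and
`π` is the Boltzmann policy (`eq_boltzmann_of_value_eq`).

For existence, the term `-λ v(t, x)` is split off the free energy; what remains is `λ`-Lipschitz in
the supremum norm, so that the Picard operator of the discounted equation contracts with factor
`1 - exp (-λ T)` on the whole horizon (`exists_solvesHJB`).

In the proofs, policies and solutions are extended from `[0, T]` to all times by composition with
the projection `clamp` onto `[0, T]`, which makes them continuous, hence measurable, everywhere.
-/

noncomputable section

/-- Purchases form a finite set and carry the discrete `σ`-algebra. -/
local instance optionMeasurableSpace {α : Type*} : MeasurableSpace (Option α) := ⊤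

local instance optionDiscrete {α : Type*} : DiscreteMeasurableSpace (Option α) :=
  ⟨fun _ => trivial⟩

/-! ### The exponential distribution -/

theorem integral_expMeasure {r : ℝ} (hr : 0 < r) (f : ℝ → ℝ) :
    ∫ x, f x ∂expMeasure r = ∫ x in Ioi 0, r * Real.exp (-(r * x)) * f x := by
  have h : expMeasure r = volume.withDensity (exponentialPDF r) := rfl
  have hm : Measurable (exponentialPDF r) := (measurable_exponentialPDFReal r).ennreal_ofReal
  rw [h, integral_withDensity_eq_integral_toReal_smul hm
    (Filter.Eventually.of_forall fun x => ENNReal.ofReal_lt_top),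
    ← integral_Ici_eq_integral_Ioi, ← integral_indicator measurableSet_Ici]
  refine integral_congr_ae (Filter.Eventually.of_forall fun x => ?_)
  by_cases hx : 0 ≤ x
  · have : 0 ≤ r * Real.exp (-(r * x)) := by positivity
    simp [exponentialPDF_of_nonneg hx, hx, ENNReal.toReal_ofReal this]
  · simp [exponentialPDF_of_neg (not_le.1 hx), hx]

theorem expMeasure_ae_pos {r : ℝ} (hr : 0 < r) : ∀ᵐ x ∂expMeasure r, 0 < x := by
  have := isProbabilityMeasure_expMeasure hr
  have h : cdf (expMeasure r) 0 = 0 := by simp [cdf_expMeasure_eq hr]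
  rw [cdf_eq_real, measureReal_eq_zero_iff] at h
  rw [ae_iff]
  simpa [Iic] using h

theorem expMeasure_Iic_lt_one {r : ℝ} (hr : 0 < r) (a : ℝ) : expMeasure r (Iic a) < 1 := by
  have := isProbabilityMeasure_expMeasure hr
  have h : cdf (expMeasure r) a < 1 := by
    rw [cdf_expMeasure_eq hr]
    split_ifs
    · linarith [Real.exp_pos (-(r * a))]
    · exact one_pos
  rw [cdf_eq_real, measureReal_def] at h
  rw [← ENNReal.toReal_lt_toReal (measure_ne_top _ _) ENNReal.one_ne_top]
  simpa using h

/-- Expectation of a function of an exponential time that is constant beyond the horizon `a`. -/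
theorem integral_expMeasure_ite {r a : ℝ} (hr : 0 < r) (ha : 0 ≤ a) (F : ℝ → ℝ) (C : ℝ)
    (hF : IntervalIntegrable (fun x => r * Real.exp (-(r * x)) * F x) volume 0 a) :
    ∫ x, (open scoped Classical in if x ∈ Ioc 0 a then F x else C) ∂expMeasure r =
      (∫ x in 0..a, r * Real.exp (-(r * x)) * F x) + Real.exp (-(r * a)) * C := by
  classical
  rw [integral_expMeasure hr, ← Ioc_union_Ioi_eq_Ioi ha]
  have hexp : (fun x : ℝ => r * Real.exp (-(r * x)) * C) =
      fun x => (r * C) * Real.exp (-r * x) := by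
    ext x; rw [neg_mul]; ring
  have e1 : EqOn (fun x => r * Real.exp (-(r * x)) * (if x ∈ Ioc 0 a then F x else C))
      (fun x => r * Real.exp (-(r * x)) * F x) (Ioc 0 a) := fun x hx => by
    simp only [if_pos hx]
  have e2 : EqOn (fun x => r * Real.exp (-(r * x)) * (if x ∈ Ioc 0 a then F x else C))
      (fun x => r * Real.exp (-(r * x)) * C) (Ioi a) := fun x hx => by
    have : x ∉ Ioc 0 a := fun h => absurd h.2 (not_le.2 hx)
    simp only [if_neg this]
  rw [setIntegral_union (Ioc_disjoint_Ioi le_rfl) measurableSet_Ioi,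
    setIntegral_congr_fun measurableSet_Ioc e1, setIntegral_congr_fun measurableSet_Ioi e2,
    intervalIntegral.integral_of_le ha]
  · congr 1
    rw [hexp, integral_const_mul, integral_exp_mul_Ioi (by linarith), neg_mul]
    field_simp
  · exact (hF.1).congr_fun e1.symm measurableSet_Ioc
  · refine IntegrableOn.congr_fun ?_ e2.symm measurableSet_Ioi
    rw [hexp]
    exact (exp_neg_integrableOn_Ioi a hr).const_mul _

/-! ### Sampling from a probability vector -/

/-- Sampling is measurable jointly in the weights and the uniform variable. -/
theorem measurableSet_sampleList {α Ω : Type*} [Inhabited α] [MeasurableSpace Ω] (l : List α)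
    {w : Ω → α → ℝ} (hw : ∀ a, Measurable fun q => w q a) (b : α) :
    ∀ {u : Ω → ℝ}, Measurable u → MeasurableSet {q | sampleList (w q) l (u q) = b} := by
  induction l with
  | nil => intro u _; simp [sampleList]
  | cons a l ih =>
    intro u hu
    have h1 : MeasurableSet {q | u q < w q a} := measurableSet_lt hu (hw a)
    have h2 := ih (u := fun q => u q - w q a) (hu.sub (hw a))
    have : {q | sampleList (w q) (a :: l) (u q) = b} =
        ({q | u q < w q a} ∩ {_q | a = b}) ∪
          ({q | u q < w q a}ᶜ ∩ {q | sampleList (w q) l (u q - w q a) = b}) := by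
      ext q
      by_cases h : u q < w q a <;> simp [sampleList, h]
    rw [this]
    exact (h1.inter (MeasurableSet.const _)).union (h1.compl.inter h2)

theorem measurable_sample {α Ω : Type*} [Fintype α] [Inhabited α] [MeasurableSpace α]
    [MeasurableSpace Ω] {w : Ω → α → ℝ} (hw : ∀ a, Measurable fun q => w q a) {u : Ω → ℝ}
    (hu : Measurable u) : Measurable fun q => sample (w q) (u q) :=
  measurable_to_countable' fun b => measurableSet_sampleList _ hw b hu

theorem sampleList_ne_default {α : Type*} [Inhabited α] {w : α → ℝ} (l : List α) :
    ∀ {u : ℝ}, 0 ≤ u →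
      sampleList w l u = default ∨ 0 < w (sampleList w l u) := by
  induction l with
  | nil => intro u _; exact Or.inl rfl
  | cons a l ih =>
    intro u hu
    by_cases h : u < w a
    · simp only [sampleList, h, if_true]
      exact Or.inr (hu.trans_lt h)
    · simp only [sampleList, h, if_false]
      exact ih (by linarith)

/-- Inverse-transform sampling never returns an outcome of weight zero, except possibly the
default one. -/
theorem sample_eq_default_or_pos {α : Type*} [Fintype α] [Inhabited α] {w : α → ℝ}
    {u : ℝ} (hu : 0 ≤ u) : sample w u = default ∨ 0 < w (sample w u) :=
  sampleList_ne_default _ hu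

/-- If the uniform variable is replaced by Lebesgue measure on `[0, s]`, where `s` is the total
weight of the list, then the weights need not add up to one. -/
theorem integral_sampleList {α : Type*} [Inhabited α] {w : α → ℝ} (hw : ∀ a, 0 ≤ w a)
    (f : α → ℝ) (l : List α) :
    IntervalIntegrable (fun u => f (sampleList w l u)) volume 0 (l.map w).sum ∧
    ∫ u in (0 : ℝ)..(l.map w).sum, f (sampleList w l u) = (l.map fun a => w a * f a).sum := by
  induction l with
  | nil => simp
  | cons a l ih =>
    have hs : 0 ≤ (l.map w).sum := List.sum_nonneg (by simpa using fun a _ => hw a)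
    have hle : w a ≤ w a + (l.map w).sum := by linarith
    have e1 : EqOn (fun u => f (sampleList w (a :: l) u)) (fun _ => f a) (Ioo 0 (w a)) :=
      fun u hu => by simp only [sampleList, hu.2, if_true]
    have e2 : EqOn (fun u => f (sampleList w (a :: l) u)) (fun u => f (sampleList w l (u - w a)))
        (Ioo (w a) (w a + (l.map w).sum)) :=
      fun u hu => by simp only [sampleList, not_lt.2 hu.1.le, if_false]
    have i1 : IntervalIntegrable (fun u => f (sampleList w (a :: l) u)) volume 0 (w a) := by
      rw [intervalIntegrable_iff_integrableOn_Ioo_of_le (hw a)]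
      exact IntegrableOn.congr_fun (by simp) e1.symm measurableSet_Ioo
    have i2' : IntervalIntegrable (fun u => f (sampleList w l (u - w a))) volume (w a)
        (w a + (l.map w).sum) := by
      have := ih.1.comp_sub_right (w a)
      rwa [zero_add, add_comm] at this
    have i2 : IntervalIntegrable (fun u => f (sampleList w (a :: l) u)) volume (w a)
        (w a + (l.map w).sum) := by
      rw [intervalIntegrable_iff_integrableOn_Ioo_of_le (by linarith)] at i2' ⊢
      exact IntegrableOn.congr_fun i2' e2.symm measurableSet_Ioo
    rw [List.map_cons, List.sum_cons, List.map_cons, List.sum_cons]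
    refine ⟨i1.trans i2, ?_⟩
    have v1 : ∫ u in (0 : ℝ)..w a, f (sampleList w (a :: l) u) = w a * f a := by
      rw [intervalIntegral.integral_of_le (hw a), integral_Ioc_eq_integral_Ioo,
        setIntegral_congr_fun measurableSet_Ioo e1]
      simp [hw a]
    have v2 : ∫ u in w a..w a + (l.map w).sum, f (sampleList w (a :: l) u) =
        ∫ u in (0 : ℝ)..(l.map w).sum, f (sampleList w l u) := by
      rw [intervalIntegral.integral_of_le hle, integral_Ioc_eq_integral_Ioo,
        setIntegral_congr_fun measurableSet_Ioo e2, ← integral_Ioc_eq_integral_Ioo,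
        ← intervalIntegral.integral_of_le hle,
        intervalIntegral.integral_comp_sub_right (fun u => f (sampleList w l u)), sub_self,
        add_sub_cancel_left]
    rw [← intervalIntegral.integral_add_adjacent_intervals i1 i2, v1, v2, ih.2]

theorem integral_sample {α : Type*} [Fintype α] [Inhabited α] {w : α → ℝ} (hw : ∀ a, 0 ≤ w a)
    (hw1 : ∑ a, w a = 1) (f : α → ℝ) :
    ∫ u : unitInterval, f (sample w (u : ℝ)) = ∑ a, w a * f a := by
  have h := (integral_sampleList hw f Finset.univ.toList).2
  rw [Finset.sum_map_toList, Finset.sum_map_toList, hw1,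
    intervalIntegral.integral_of_le zero_le_one, ← integral_Icc_eq_integral_Ioc] at h
  rw [← h]
  exact integral_subtype measurableSet_Icc fun u => f (sample w u)

/-! ### Splitting off the first factor of an infinite product -/

/-- The sequence with first term `z` and remaining terms `ω`. -/
def seqCons {α : Type*} (z : α) (ω : ℕ → α) : ℕ → α
  | 0 => z
  | k + 1 => ω k

theorem measurable_seqCons {α : Type*} [MeasurableSpace α] :
    Measurable fun p : α × (ℕ → α) => seqCons p.1 p.2 := by
  refine measurable_pi_iff.2 fun k => ?_
  cases k with
  | zero => exact measurable_fst
  | succ k => exact (measurable_pi_apply k).comp measurable_snd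

theorem measurePreserving_seqCons {α : Type*} [MeasurableSpace α] (μ : Measure α)
    [IsProbabilityMeasure μ] :
    MeasurePreserving (fun p : α × (ℕ → α) => seqCons p.1 p.2)
      (μ.prod (Measure.infinitePi fun _ : ℕ => μ)) (Measure.infinitePi fun _ : ℕ => μ) := by
  refine ⟨measurable_seqCons, Measure.eq_infinitePi _ fun s t ht => ?_⟩
  classical
  rw [Measure.map_apply measurable_seqCons (.pi s.countable_toSet fun i _ => ht i)]
  let s' : Finset ℕ := s.preimage Nat.succ Nat.succ_injective.injOn
  have hs' : ∀ k, k ∈ s' ↔ k + 1 ∈ s := fun k => by simp [s']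
  have hpre : (fun p : α × (ℕ → α) => seqCons p.1 p.2) ⁻¹' (Set.pi s t) =
      (if 0 ∈ s then t 0 else univ) ×ˢ (Set.pi s' fun k => t (k + 1)) := by
    ext p
    simp only [mem_preimage, Set.mem_pi, mem_prod, Finset.mem_coe, hs']
    constructor
    · intro h
      refine ⟨?_, fun k hk => h (k + 1) hk⟩
      split_ifs with h0
      · exact h 0 h0
      · trivial
    · rintro ⟨h0, h1⟩ k hk
      cases k with
      | zero => rw [if_pos hk] at h0; exact h0
      | succ k => exact h1 k hk
  rw [hpre, Measure.prod_prod, Measure.infinitePi_pi _ fun i _ => ht _]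
  have himg : s.erase 0 = s'.map ⟨Nat.succ, Nat.succ_injective⟩ := by
    ext k
    cases k with
    | zero => simp
    | succ k => simp [hs']
  have hprod : ∏ i ∈ s' , μ (t (i + 1)) = ∏ i ∈ s.erase 0, μ (t i) := by
    rw [himg, Finset.prod_map]; rfl
  rw [hprod]
  split_ifs with h0
  · exact Finset.mul_prod_erase s (fun i => μ (t i)) h0
  · rw [measure_univ, one_mul, Finset.erase_eq_of_notMem h0]

namespace NRM

variable {m n : ℕ} {M : NRM m n}

/-! ### Policies continuous on the whole time line -/

/-- Policies that are feasible and continuous at all real times, not only during the selling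
horizon. -/
structure IsRegular (M : NRM m n) (π : M.Policy) : Prop where
  nonneg : ∀ t x S, 0 ≤ π t x S
  sum_eq_one : ∀ t x, ∑ S, π t x S = 1
  eq_zero : ∀ t x, ∀ S ∉ M.feasible x, π t x S = 0
  continuous : ∀ x S, Continuous fun t => π t x S

theorem zero_mem_horizon (M : NRM m n) : (0 : ℝ) ∈ Icc 0 M.T := ⟨le_rfl, M.T_pos.le⟩

/-- The nearest point of the selling horizon `[0, T]`. -/
def clamp (M : NRM m n) (t : ℝ) : ℝ := projIcc 0 M.T M.T_pos.le t

theorem clamp_mem (M : NRM m n) (t : ℝ) : M.clamp t ∈ Icc 0 M.T := (projIcc 0 M.T _ t).2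

theorem clamp_of_mem {t : ℝ} (ht : t ∈ Icc 0 M.T) : M.clamp t = t := by
  rw [clamp, projIcc_of_mem _ ht]

theorem continuous_clamp (M : NRM m n) : Continuous M.clamp :=
  continuous_subtype_val.comp continuous_projIcc

theorem continuous_comp_clamp {f : ℝ → ℝ} (hf : ContinuousOn f (Icc 0 M.T)) :
    Continuous fun t => f (M.clamp t) :=
  hf.comp_continuous M.continuous_clamp M.clamp_mem

theorem IsAdmissible.isRegular_clamp {π : M.Policy} (hπ : M.IsAdmissible π) :
    M.IsRegular fun t => π (M.clamp t) where
  nonneg t := hπ.nonneg _ (M.clamp_mem t)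
  sum_eq_one t := hπ.sum_eq_one _ (M.clamp_mem t)
  eq_zero t := hπ.eq_zero _ (M.clamp_mem t)
  continuous x S := continuous_comp_clamp (hπ.continuousOn x S)

/-- The reward depends on the policy only through its values during the selling horizon. -/
theorem reward_congr {π π' : M.Policy} (h : ∀ s ∈ Icc 0 M.T, π s = π' s) {t : ℝ}
    (ht : t ∈ Icc 0 M.T) (x : M.State) : M.reward π t x = M.reward π' t x := by
  funext ω
  have h1 : M.outcome π t ω = M.outcome π' t ω := by
    funext k y
    unfold outcome
    split_ifs with hk
    · rw [purchase, purchase, h _ ⟨ht.1.trans hk.1.le, hk.2⟩]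
    · rfl
  have h2 : M.preState π t x ω = M.preState π' t x ω := by
    funext k
    induction k with
    | zero => rfl
    | succ k ih => rw [preState, preState, ih, h1]
  have h3 : M.sale π t x ω = M.sale π' t x ω := by
    funext k; rw [sale, sale, h1, h2]
  rw [reward, reward, h3]
  congr 2
  refine intervalIntegral.integral_congr fun s hs => ?_
  rw [uIcc_of_le ht.2] at hs
  simp only [leftState, h2, entropy, h s ⟨ht.1.trans hs.1, hs.2⟩]

theorem value_congr {π π' : M.Policy} (h : ∀ s ∈ Icc 0 M.T, π s = π' s) {t : ℝ}
    (ht : t ∈ Icc 0 M.T) (x : M.State) : M.value π t x = M.value π' t x := by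
  rw [value, value, reward_congr h ht]

theorem eq_comp_clamp (π : M.Policy) :
    ∀ s ∈ Icc 0 M.T, π s = (fun t => π (M.clamp t)) s := fun s hs => by
  simp only [clamp_of_mem hs]

/-! ### The rewards are bounded -/

namespace IsRegular

variable {π : M.Policy}

theorem purchase_feasible (hπ : M.IsRegular π) {τ : ℝ} {x : M.State} {z : Noise} {j : Fin n}
    (h : M.purchase π τ x z = some j) (i : Fin m) : M.A i j ≤ (x i : ℕ) := by
  have hmem : j ∈ sample (π τ x) (z.2.1 : ℝ) := by
    by_contra hj
    have h1 := sample_eq_default_or_pos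
      (w := M.choiceProb (sample (π τ x) (z.2.1 : ℝ))) z.2.2.2.1
    rw [purchase] at h
    rw [h, M.choiceProb_notMem _ _ hj] at h1
    exact h1.elim (fun h => by cases h) (lt_irrefl _)
  rcases sample_eq_default_or_pos (w := π τ x) z.2.1.2.1 with h2 | h2
  · rw [h2] at hmem
    exact absurd hmem (Finset.notMem_empty j)
  · have : sample (π τ x) (z.2.1 : ℝ) ∈ M.feasible x := by
      by_contra h3
      exact h2.ne' (hπ.eq_zero _ _ _ h3)
    exact (Finset.mem_filter.1 this).2 j hmem i

theorem outcome_feasible (hπ : M.IsRegular π) {t : ℝ} {x : M.State} {ω : ℕ → Noise} {k : ℕ}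
    {j : Fin n} (h : M.outcome π t ω k x = some j) (i : Fin m) : M.A i j ≤ (x i : ℕ) := by
  unfold outcome at h
  split_ifs at h with hk
  exact hπ.purchase_feasible h i

/-- Every sale uses up at least one unit of some resource, so that on every path the number of
sales is at most the total initial inventory. -/
theorem sum_sale_add_le (hπ : M.IsRegular π) (t : ℝ) (x : M.State) (ω : ℕ → Noise) (N : ℕ) :
    ∑ k ∈ Finset.range N, (if M.sale π t x ω k = none then 0 else 1) +
      ∑ i, (M.preState π t x ω N i : ℕ) ≤ ∑ i, (x i : ℕ) := by
  induction N with
  | zero => simp [preState]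
  | succ N ih =>
    refine le_trans ?_ ih
    rw [Finset.sum_range_succ, add_assoc, preState]
    refine Nat.add_le_add_left ?_ _
    change (if M.sale π t x ω N = none then 0 else 1) +
      ∑ i, (M.sell (M.preState π t x ω N) (M.sale π t x ω N) i : ℕ) ≤ _
    cases ho : M.sale π t x ω N with
    | none => simp [sell]
    | some j =>
      have hA := hπ.outcome_feasible (j := j) ho
      obtain ⟨i₀, hi₀⟩ := M.A_ne_zero j
      simp only [reduceCtorEq, if_false, sell]
      rw [add_comm, Nat.add_one_le_iff]
      refine Finset.sum_lt_sum (fun i _ => Nat.sub_le _ _) ⟨i₀, Finset.mem_univ _, ?_⟩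
      have := hA i₀
      omega

theorem sum_abs_revenue_le (hπ : M.IsRegular π) (t : ℝ) (x : M.State) (ω : ℕ → Noise) (N : ℕ) :
    ∑ k ∈ Finset.range N, |M.revenue (M.sale π t x ω k)| ≤
      (∑ j, |M.price j|) * ∑ i, (M.c i : ℝ) := by
  have h1 : ∀ o, |M.revenue o| ≤
      (∑ j, |M.price j|) * ((if o = none then 0 else 1 : ℕ) : ℝ) := fun o => by
    cases o with
    | none => simp [revenue]
    | some j =>
      simpa [revenue] using
        Finset.single_le_sum (f := fun j => |M.price j|) (fun j _ => abs_nonneg _)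
          (Finset.mem_univ j)
  refine (Finset.sum_le_sum fun k _ => h1 _).trans ?_
  rw [← Finset.mul_sum]
  refine mul_le_mul_of_nonneg_left ?_ (Finset.sum_nonneg fun j _ => abs_nonneg _)
  have h2 := hπ.sum_sale_add_le t x ω N
  have h3 : ∑ i, (x i : ℕ) ≤ ∑ i, M.c i := Finset.sum_le_sum fun i _ => Nat.lt_succ_iff.1 (x i).2
  exact_mod_cast (Nat.le_add_right _ _).trans (h2.trans h3)

theorem summable_revenue (hπ : M.IsRegular π) (t : ℝ) (x : M.State) (ω : ℕ → Noise) :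
    Summable fun k => M.revenue (M.sale π t x ω k) :=
  (summable_of_sum_range_le (fun _ => abs_nonneg _) (hπ.sum_abs_revenue_le t x ω)).of_abs

theorem abs_tsum_revenue_le (hπ : M.IsRegular π) (t : ℝ) (x : M.State) (ω : ℕ → Noise) :
    |∑' k, M.revenue (M.sale π t x ω k)| ≤ (∑ j, |M.price j|) * ∑ i, (M.c i : ℝ) := by
  have hs := (hπ.summable_revenue t x ω).abs
  refine le_trans ?_ (Real.tsum_le_of_sum_range_le (fun _ => abs_nonneg _)
    (hπ.sum_abs_revenue_le t x ω))
  have := norm_tsum_le_tsum_norm (f := fun k => M.revenue (M.sale π t x ω k)) hs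
  simpa using this

theorem le_one (hπ : M.IsRegular π) (t : ℝ) (x : M.State) (S : Finset (Fin n)) : π t x S ≤ 1 := by
  rw [← hπ.sum_eq_one t x]
  exact Finset.single_le_sum (fun S _ => hπ.nonneg t x S) (Finset.mem_univ S)

theorem abs_entropy_le (hπ : M.IsRegular π) (t : ℝ) (x : M.State) :
    |M.entropy π t x| ≤ Fintype.card (Finset (Fin n)) := by
  rw [entropy, abs_neg]
  refine (Finset.abs_sum_le_sum_abs _ _).trans ?_
  refine (Finset.sum_le_card_nsmul _ _ 1 fun S _ => ?_).trans ?_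
  · rcases (hπ.nonneg t x S).eq_or_lt with h | h
    · simp [← h]
    · rw [mul_comm]
      exact (Real.abs_log_mul_self_lt _ h (hπ.le_one t x S)).le
  · rw [nsmul_eq_mul, mul_one]
    exact_mod_cast Finset.card_le_univ (M.feasible x)

theorem continuous_entropy (hπ : M.IsRegular π) (x : M.State) :
    Continuous fun t => M.entropy π t x := by
  unfold entropy
  exact (continuous_finsetSum _ fun S _ => Real.continuous_mul_log.comp (hπ.continuous x S)).neg

theorem exists_abs_reward_le (hπ : M.IsRegular π) :
    ∃ C, ∀ t ∈ Icc 0 M.T, ∀ x ω, |M.reward π t x ω| ≤ C := by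
  refine ⟨(∑ j, |M.price j|) * ∑ i, (M.c i : ℝ) +
    M.temp * (Fintype.card (Finset (Fin n)) * M.T), fun t ht x ω => ?_⟩
  refine (abs_add_le _ _).trans (add_le_add (hπ.abs_tsum_revenue_le t x ω) ?_)
  rw [abs_mul, abs_of_pos M.temp_pos]
  refine mul_le_mul_of_nonneg_left ?_ M.temp_pos.le
  have h : ∀ s ∈ uIoc t M.T, ‖M.entropy π s (M.leftState π t x ω s)‖ ≤
      Fintype.card (Finset (Fin n)) := fun s _ => hπ.abs_entropy_le s _
  refine (intervalIntegral.norm_integral_le_of_norm_le_const h).trans ?_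
  rw [abs_of_nonneg (sub_nonneg.2 ht.2)]
  exact mul_le_mul_of_nonneg_left (by linarith [ht.1]) (Nat.cast_nonneg _)

end IsRegular

/-! ### The rewards are measurable -/

/-- A measurable choice among countably many measurable functions is measurable. -/
theorem measurable_apply_countable {α Ω γ : Type*} [Countable α] [MeasurableSpace α]
    [MeasurableSingletonClass α] [MeasurableSpace Ω] [MeasurableSpace γ] {f : α → Ω → γ}
    (hf : ∀ a, Measurable (f a)) {g : Ω → α} (hg : Measurable g) :
    Measurable fun ω => f (g ω) ω := by
  have h : Measurable fun p : α × Ω => f p.1 p.2 := measurable_from_prod_countable_right hf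
  exact h.fun_comp (hg.prodMk measurable_id')

theorem measurable_arrival (t : ℝ) (k : ℕ) : Measurable fun ω : ℕ → Noise => arrival t ω k := by
  unfold arrival
  fun_prop

namespace IsRegular

variable {π : M.Policy}

theorem measurable_purchase (hπ : M.IsRegular π) (x : M.State) :
    Measurable fun q : ℝ × Noise => M.purchase π q.1 x q.2 := by
  have h1 : Measurable fun q : ℝ × Noise => sample (π q.1 x) (q.2.2.1 : ℝ) :=
    measurable_sample (u := fun q : ℝ × Noise => (q.2.2.1 : ℝ))
      (fun S => (hπ.continuous x S).measurable.comp measurable_fst) (by fun_prop)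
  exact measurable_apply_countable
    (f := fun S (q : ℝ × Noise) => sample (M.choiceProb S) (q.2.2.2 : ℝ))
    (fun S => measurable_sample (w := fun _ => M.choiceProb S)
      (u := fun q : ℝ × Noise => (q.2.2.2 : ℝ)) (fun _ => measurable_const) (by fun_prop)) h1

theorem measurable_outcome (hπ : M.IsRegular π) (t : ℝ) (k : ℕ) (y : M.State) :
    Measurable fun ω => M.outcome π t ω k y := by
  unfold outcome
  refine Measurable.ite (measurable_arrival t k measurableSet_Ioc) ?_ measurable_const
  exact (hπ.measurable_purchase y).comp ((measurable_arrival t k).prodMk (measurable_pi_apply k))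

theorem measurable_preState (hπ : M.IsRegular π) (t : ℝ) (x : M.State) (k : ℕ) :
    Measurable fun ω => M.preState π t x ω k := by
  induction k with
  | zero => exact measurable_const
  | succ k ih =>
    simp only [preState]
    exact measurable_apply_countable (f := fun y ω => M.sell y (M.outcome π t ω k y))
      (fun y => (Measurable.of_discrete (f := M.sell y)).comp (hπ.measurable_outcome t k y)) ih

theorem measurable_sale (hπ : M.IsRegular π) (t : ℝ) (x : M.State) (k : ℕ) :
    Measurable fun ω => M.sale π t x ω k := by
  exact measurable_apply_countable (f := fun y ω => M.outcome π t ω k y)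
    (hπ.measurable_outcome t k) (hπ.measurable_preState t x k)

end IsRegular

theorem measurable_arrivalIndex (t : ℝ) :
    Measurable fun p : (ℕ → Noise) × ℝ => sInf {k | p.2 ≤ arrival t p.1 k} := by
  have hm : ∀ k, MeasurableSet {p : (ℕ → Noise) × ℝ | p.2 ≤ arrival t p.1 k} := fun k =>
    measurableSet_le measurable_snd ((measurable_arrival t k).comp measurable_fst)
  refine measurable_to_countable' fun k => ?_
  have : (fun p : (ℕ → Noise) × ℝ => sInf {k | p.2 ≤ arrival t p.1 k}) ⁻¹' {k} =
      ({p | p.2 ≤ arrival t p.1 k} ∩ ⋂ j ∈ Iio k, {p | p.2 ≤ arrival t p.1 j}ᶜ) ∪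
        ({_p | k = 0} ∩ ⋂ j, {p | p.2 ≤ arrival t p.1 j}ᶜ) := by
    ext p
    simp only [mem_preimage, mem_singleton_iff, mem_union, mem_inter_iff, mem_iInter, mem_compl_iff,
      mem_ofPred_eq, mem_Iio]
    constructor
    · rintro rfl
      by_cases hne : {k | p.2 ≤ arrival t p.1 k}.Nonempty
      · exact Or.inl ⟨Nat.sInf_mem hne, fun j hj => Nat.notMem_of_lt_sInf hj⟩
      · rw [not_nonempty_iff_eq_empty] at hne
        refine Or.inr ⟨by rw [hne, Nat.sInf_empty], fun j hj => ?_⟩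
        have : j ∈ {k | p.2 ≤ arrival t p.1 k} := hj
        rw [hne] at this
        exact this
    · rintro (⟨h1, h2⟩ | ⟨rfl, h2⟩)
      · refine le_antisymm (Nat.sInf_le h1) (le_of_not_gt fun hlt => ?_)
        exact h2 _ hlt (Nat.sInf_mem (s := {k | p.2 ≤ arrival t p.1 k}) ⟨k, h1⟩)
      · have : {k | p.2 ≤ arrival t p.1 k} = ∅ := eq_empty_of_forall_notMem h2
        rw [this, Nat.sInf_empty]
  rw [this]
  exact ((hm k).inter (.biInter (to_countable _) fun j _ => (hm j).compl)).union
    ((MeasurableSet.const _).inter (.iInter fun j => (hm j).compl))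

namespace IsRegular

variable {π : M.Policy}

theorem measurable_leftState (hπ : M.IsRegular π) (t : ℝ) (x : M.State) :
    Measurable fun p : (ℕ → Noise) × ℝ => M.leftState π t x p.1 p.2 := by
  exact measurable_apply_countable
    (f := fun k (p : (ℕ → Noise) × ℝ) => M.preState π t x p.1 k)
    (fun k => (hπ.measurable_preState t x k).comp measurable_fst) (measurable_arrivalIndex t)

theorem measurable_entropy_leftState (hπ : M.IsRegular π) (t : ℝ) (x : M.State) :
    Measurable fun p : (ℕ → Noise) × ℝ => M.entropy π p.2 (M.leftState π t x p.1 p.2) := by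
  exact measurable_apply_countable (f := fun y (p : (ℕ → Noise) × ℝ) => M.entropy π p.2 y)
    (fun y => (hπ.continuous_entropy y).measurable.comp measurable_snd)
    (hπ.measurable_leftState t x)

theorem measurable_reward (hπ : M.IsRegular π) {t : ℝ} (ht : t ∈ Icc 0 M.T) (x : M.State) :
    Measurable (M.reward π t x) := by
  refine Measurable.add ?_ (Measurable.const_mul ?_ _)
  · refine measurable_of_tendsto_metrizable (f := fun N ω =>
      ∑ k ∈ Finset.range N, M.revenue (M.sale π t x ω k)) (fun N => ?_) ?_
    · exact Finset.measurable_sum _ fun k _ =>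
        (Measurable.of_discrete (f := M.revenue)).comp (hπ.measurable_sale t x k)
    · rw [tendsto_pi_nhds]
      exact fun ω => (hπ.summable_revenue t x ω).hasSum.tendsto_sum_nat
  · simp_rw [intervalIntegral.integral_of_le ht.2]
    exact (hπ.measurable_entropy_leftState t x).stronglyMeasurable.integral_prod_right'.measurable

end IsRegular

instance : IsProbabilityMeasure M.law := by
  unfold law
  infer_instance

theorem IsRegular.integrable_reward {π : M.Policy} (hπ : M.IsRegular π) {t : ℝ}
    (ht : t ∈ Icc 0 M.T) (x : M.State) : Integrable (M.reward π t x) M.law := by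
  obtain ⟨C, hC⟩ := hπ.exists_abs_reward_le
  exact Integrable.of_bound (hπ.measurable_reward ht x).aestronglyMeasurable C
    (Filter.Eventually.of_forall fun ω => hC t ht x ω)

theorem IsRegular.exists_abs_value_le {π : M.Policy} (hπ : M.IsRegular π) :
    ∃ C, ∀ t ∈ Icc 0 M.T, ∀ x, |M.value π t x| ≤ C := by
  obtain ⟨C, hC⟩ := hπ.exists_abs_reward_le
  refine ⟨C, fun t ht x => ?_⟩
  have := norm_integral_le_of_norm_le_const (μ := M.law) (f := M.reward π t x) (C := C)
    (Filter.Eventually.of_forall fun ω => hC t ht x ω)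
  simpa [value] using this

/-! ### The renewal equation at the first arrival -/

/-- The running reward `h` up to the first arrival after `t`, plus the revenue from that arrival
and a continuation value `w` for the time and state after it; without an arrival in `(t, T]`, the
running reward up to `T`. -/
def arrivalStep (h : ℝ → M.State → ℝ) (π : M.Policy) (w : ℝ → M.State → ℝ) (t : ℝ) (x : M.State)
    (z : Noise) : ℝ :=
  open scoped Classical in
  if t + z.1 ∈ Ioc t M.T then
    (∫ s in t..t + z.1, h s x) + (M.revenue (M.purchase π (t + z.1) x z) +
      w (t + z.1) (M.sell x (M.purchase π (t + z.1) x z)))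
  else ∫ s in t..M.T, h s x

theorem noiseLaw_ae_pos (M : NRM m n) : ∀ᵐ z ∂M.noiseLaw, 0 < z.1 := by
  have := isProbabilityMeasure_expMeasure M.rate_pos
  exact Measure.quasiMeasurePreserving_fst.ae (expMeasure_ae_pos M.rate_pos)

theorem law_ae_pos (M : NRM m n) : ∀ᵐ ω ∂M.law, ∀ k, 0 < (ω k).1 := by
  rw [ae_all_iff]
  exact fun k => (measurePreserving_eval_infinitePi (fun _ : ℕ => M.noiseLaw)
    k).quasiMeasurePreserving.ae M.noiseLaw_ae_pos

/-- Almost surely some interarrival time exceeds `a`: the probability that none of the first `N`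
does is the `N`-th power of a number below one. -/
theorem law_ae_exists_lt (M : NRM m n) (a : ℝ) : ∀ᵐ ω ∂M.law, ∃ k, a < (ω k).1 := by
  have hprob := isProbabilityMeasure_expMeasure M.rate_pos
  have hm : MeasurableSet {z : Noise | z.1 ≤ a} := measurableSet_le measurable_fst measurable_const
  have h1 : M.noiseLaw {z | z.1 ≤ a} < 1 := by
    have : {z : Noise | z.1 ≤ a} = Iic a ×ˢ univ := by ext z; simp
    rw [this, noiseLaw, Measure.prod_prod, measure_univ, mul_one]
    exact expMeasure_Iic_lt_one M.rate_pos a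
  have h2 : ∀ N : ℕ, M.law {ω | ¬ ∃ k, a < (ω k).1} ≤ (M.noiseLaw {z | z.1 ≤ a}) ^ N := fun N => by
    calc M.law {ω | ¬ ∃ k, a < (ω k).1}
        ≤ M.law (Set.pi (Finset.range N) fun _ => {z : Noise | z.1 ≤ a}) :=
          measure_mono fun ω hω k _ => not_lt.1 fun hk => hω ⟨k, hk⟩
      _ = _ := by
          rw [law, Measure.infinitePi_pi _ fun _ _ => hm, Finset.prod_const, Finset.card_range]
  rw [ae_iff]
  exact le_antisymm (ge_of_tendsto' (ENNReal.tendsto_pow_atTop_nhds_zero_of_lt_one h1) h2) zero_le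

theorem arrival_seqCons_zero (t : ℝ) (z : Noise) (ω : ℕ → Noise) :
    arrival t (seqCons z ω) 0 = t + z.1 := by
  simp [arrival, seqCons]

theorem arrival_seqCons_succ (t : ℝ) (z : Noise) (ω : ℕ → Noise) (k : ℕ) :
    arrival t (seqCons z ω) (k + 1) = arrival (t + z.1) ω k := by
  simp only [arrival, Finset.sum_range_succ' _ (k + 1), seqCons]
  ring

theorem le_arrival {t : ℝ} {ω : ℕ → Noise} (hω : ∀ k, 0 < (ω k).1) (k : ℕ) :
    t + (ω k).1 ≤ arrival t ω k := by
  have := Finset.single_le_sum (f := fun i => (ω i).1) (s := Finset.range (k + 1))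
    (fun i _ => (hω i).le) (Finset.self_mem_range_succ k)
  simpa [arrival] using this

theorem lt_arrival {t : ℝ} {ω : ℕ → Noise} (hω : ∀ k, 0 < (ω k).1) (k : ℕ) :
    t < arrival t ω k :=
  (lt_add_of_pos_right t (hω k)).trans_le (le_arrival hω k)

section path

variable {π : M.Policy} {t : ℝ} {z : Noise} {ω : ℕ → Noise}

theorem outcome_seqCons_zero (hz : t + z.1 ∈ Ioc t M.T) (y : M.State) :
    M.outcome π t (seqCons z ω) 0 y = M.purchase π (t + z.1) y z := by
  rw [outcome, arrival_seqCons_zero, if_pos hz]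
  rfl

theorem outcome_seqCons_succ (hz : t + z.1 ∈ Ioc t M.T) (hω : ∀ k, 0 < (ω k).1) (k : ℕ)
    (y : M.State) : M.outcome π t (seqCons z ω) (k + 1) y = M.outcome π (t + z.1) ω k y := by
  have h := lt_arrival (t := t + z.1) hω k
  have hiff : arrival (t + z.1) ω k ∈ Ioc t M.T ↔ arrival (t + z.1) ω k ∈ Ioc (t + z.1) M.T :=
    ⟨fun h' => ⟨h, h'.2⟩, fun h' => ⟨hz.1.trans h, h'.2⟩⟩
  simp only [outcome, arrival_seqCons_succ, hiff]
  rfl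

theorem preState_seqCons_succ (hz : t + z.1 ∈ Ioc t M.T) (hω : ∀ k, 0 < (ω k).1) (x : M.State)
    (k : ℕ) : M.preState π t x (seqCons z ω) (k + 1) =
      M.preState π (t + z.1) (M.sell x (M.purchase π (t + z.1) x z)) ω k := by
  induction k with
  | zero => rw [preState, preState, preState, outcome_seqCons_zero hz]
  | succ k ih => rw [preState, ih, outcome_seqCons_succ hz hω, ← preState]

/-- No state change is visible up to and including the first arrival. -/
theorem leftState_of_le_first {s : ℝ} (hs : s ≤ t + z.1) (x : M.State) :
    M.leftState π t x (seqCons z ω) s = x := by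
  have : sInf {k | s ≤ arrival t (seqCons z ω) k} = 0 :=
    Nat.sInf_eq_zero.2 (Or.inl (by rwa [mem_ofPred_eq, arrival_seqCons_zero]))
  rw [leftState, this, preState]

/-- Some customer has to arrive at or after `s`: otherwise the infimum of the empty set would make
both left states fall back to the respective initial states, which differ. -/
theorem leftState_of_first_lt (hz : t + z.1 ∈ Ioc t M.T) (hω : ∀ k, 0 < (ω k).1) {s : ℝ}
    (hs : t + z.1 < s) (hex : ∃ k, s ≤ arrival (t + z.1) ω k) (x : M.State) :
    M.leftState π t x (seqCons z ω) s =
      M.leftState π (t + z.1) (M.sell x (M.purchase π (t + z.1) x z)) ω s := by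
  obtain ⟨k, hk⟩ := hex
  have hne : {k | s ≤ arrival t (seqCons z ω) k}.Nonempty :=
    ⟨k + 1, by rwa [mem_ofPred_eq, arrival_seqCons_succ]⟩
  have h1 : 1 ≤ sInf {k | s ≤ arrival t (seqCons z ω) k} := by
    by_contra h0
    have h2 := Nat.sInf_mem hne
    rw [Nat.lt_one_iff.1 (not_le.1 h0), mem_ofPred_eq, arrival_seqCons_zero] at h2
    exact absurd h2 (not_le.2 hs)
  rw [leftState, ← Nat.sInf_add h1, preState_seqCons_succ hz hω]
  simp only [arrival_seqCons_succ, leftState]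

theorem IsRegular.intervalIntegrable_entropy_leftState (hπ : M.IsRegular π) (t : ℝ) (x : M.State)
    (ω : ℕ → Noise) (a b : ℝ) :
    IntervalIntegrable (fun s => M.entropy π s (M.leftState π t x ω s)) volume a b := by
  have hm : Measurable fun s => M.entropy π s (M.leftState π t x ω s) :=
    Measurable.of_uncurry_left (f := fun ω s => M.entropy π s (M.leftState π t x ω s))
      (hπ.measurable_entropy_leftState t x)
  have hb : ∀ s, ‖M.entropy π s (M.leftState π t x ω s)‖ ≤ Fintype.card (Finset (Fin n)) :=
    fun s => hπ.abs_entropy_le s _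
  rw [intervalIntegrable_iff]
  exact Measure.integrableOn_of_bounded measure_Ioc_lt_top.ne hm.aestronglyMeasurable
    (Filter.Eventually.of_forall hb)

/-- The strong Markov property at the first arrival, on the level of paths. -/
theorem IsRegular.reward_seqCons (hπ : M.IsRegular π) (ht : t ∈ Icc 0 M.T) (hz : 0 < z.1)
    (hω : ∀ k, 0 < (ω k).1) (hT : ∃ k, M.T < (ω k).1) (x : M.State) :
    M.reward π t x (seqCons z ω) =
      M.arrivalStep (fun s y => M.temp * M.entropy π s y) π
        (fun τ y => M.reward π τ y ω) t x z := by
  unfold arrivalStep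
  beta_reduce
  split_ifs with hmem
  · have hint := hπ.intervalIntegrable_entropy_leftState t x (seqCons z ω)
    have e1 : ∫ s in t..t + z.1, M.entropy π s (M.leftState π t x (seqCons z ω) s) =
        ∫ s in t..t + z.1, M.entropy π s x := by
      rw [intervalIntegral.integral_of_le hmem.1.le, intervalIntegral.integral_of_le hmem.1.le]
      exact setIntegral_congr_fun measurableSet_Ioc fun s hs => by
        simp only [leftState_of_le_first hs.2]
    have e2 : ∫ s in t + z.1..M.T, M.entropy π s (M.leftState π t x (seqCons z ω) s) =
        ∫ s in t + z.1..M.T, M.entropy π s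
          (M.leftState π (t + z.1) (M.sell x (M.purchase π (t + z.1) x z)) ω s) := by
      rw [intervalIntegral.integral_of_le hmem.2, intervalIntegral.integral_of_le hmem.2]
      refine setIntegral_congr_fun measurableSet_Ioc fun s hs => ?_
      obtain ⟨k, hk⟩ := hT
      have hex : s ≤ arrival (t + z.1) ω k := by
        have := le_arrival (t := t + z.1) hω k
        linarith [hs.2, ht.1]
      simp only [leftState_of_first_lt hmem hω hs.1 ⟨k, hex⟩]
    have e3 : ∀ k, M.sale π t x (seqCons z ω) (k + 1) =
        M.sale π (t + z.1) (M.sell x (M.purchase π (t + z.1) x z)) ω k := fun k => by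
      rw [sale, sale, outcome_seqCons_succ hmem hω, preState_seqCons_succ hmem hω]
    have e4 : M.sale π t x (seqCons z ω) 0 = M.purchase π (t + z.1) x z := by
      rw [sale, preState, outcome_seqCons_zero hmem]
    rw [reward, (hπ.summable_revenue t x _).tsum_eq_zero_add,
      ← intervalIntegral.integral_add_adjacent_intervals (hint t (t + z.1)) (hint (t + z.1) M.T),
      e1, e2, intervalIntegral.integral_const_mul, reward, e4]
    simp only [e3]
    ring
  · have hgt : M.T < t + z.1 := by
      by_contra h
      exact hmem ⟨by linarith, not_lt.1 h⟩
    have e1 : ∀ k, M.sale π t x (seqCons z ω) k = none := fun k => by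
      have : arrival t (seqCons z ω) k ∉ Ioc t M.T := fun h => by
        cases k with
        | zero => rw [arrival_seqCons_zero] at h; exact hmem h
        | succ k =>
          rw [arrival_seqCons_succ] at h
          exact absurd (hgt.trans (lt_arrival hω k)) (not_lt.2 h.2)
      rw [sale, outcome, if_neg this]
    simp only [reward, e1]
    rw [intervalIntegral.integral_const_mul]
    simp only [revenue, Option.elim_none, tsum_zero, zero_add]
    congr 1
    rw [intervalIntegral.integral_of_le ht.2, intervalIntegral.integral_of_le ht.2]
    exact setIntegral_congr_fun measurableSet_Ioc fun s hs => by
      simp only [leftState_of_le_first (hs.2.trans hgt.le)]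

end path

/-- The renewal equation for the value of a policy. -/
theorem IsRegular.value_eq_integral {π : M.Policy} (hπ : M.IsRegular π) {t : ℝ}
    (ht : t ∈ Icc 0 M.T) (x : M.State) :
    Integrable (M.arrivalStep (fun s y => M.temp * M.entropy π s y) π (M.value π) t x) M.noiseLaw ∧
    M.value π t x =
      ∫ z, M.arrivalStep (fun s y => M.temp * M.entropy π s y) π (M.value π) t x z ∂M.noiseLaw := by
  have hmp := measurePreserving_seqCons M.noiseLaw
  change MeasurePreserving _ (M.noiseLaw.prod M.law) M.law at hmp
  have hint : Integrable (fun p : Noise × (ℕ → Noise) => M.reward π t x (seqCons p.1 p.2))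
      (M.noiseLaw.prod M.law) :=
    hmp.integrable_comp_of_integrable (hπ.integrable_reward ht x)
  have hinner : ∀ᵐ z ∂M.noiseLaw, ∫ ω, M.reward π t x (seqCons z ω) ∂M.law =
      M.arrivalStep (fun s y => M.temp * M.entropy π s y) π (M.value π) t x z := by
    filter_upwards [M.noiseLaw_ae_pos] with z hz
    have h1 : ∀ᵐ ω ∂M.law, M.reward π t x (seqCons z ω) =
        M.arrivalStep (fun s y => M.temp * M.entropy π s y) π
          (fun τ y => M.reward π τ y ω) t x z := by
      filter_upwards [M.law_ae_pos, M.law_ae_exists_lt M.T] with ω h1 h2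
      exact hπ.reward_seqCons ht hz h1 h2 x
    rw [integral_congr_ae h1]
    unfold arrivalStep
    split_ifs with hmem
    · have hr := hπ.integrable_reward (t := t + z.1) ⟨ht.1.trans hmem.1.le, hmem.2⟩
        (M.sell x (M.purchase π (t + z.1) x z))
      simp_rw [← add_assoc]
      rw [integral_add (integrable_const _) hr]
      simp [value]
    · simp
  refine ⟨hint.integral_prod_left.congr hinner, ?_⟩
  rw [← integral_congr_ae hinner, ← integral_prod _ hint, value]
  conv_lhs => rw [← hmp.map_eq]
  exact integral_map hmp.aemeasurable (by
    rw [hmp.map_eq]; exact (hπ.integrable_reward ht x).aestronglyMeasurable)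

/-! ### The verification identity -/

/-- The expected revenue from a customer who arrives at time `t` in state `x`, plus the expected
continuation value `w` after that customer. -/
def meanNext (π : M.Policy) (w : ℝ → M.State → ℝ) (t : ℝ) (x : M.State) : ℝ :=
  ∑ S, π t x S * ∑ o, M.choiceProb S o * (M.revenue o + w t (M.sell x o))

theorem exists_abs_le_of_continuous {f : ℝ → M.State → ℝ} (hf : ∀ x, Continuous fun t => f t x) :
    ∃ C, ∀ t ∈ Icc 0 M.T, ∀ x, |f t x| ≤ C := by
  have h : ∀ x, ∃ C, ∀ t ∈ Icc 0 M.T, |f t x| ≤ C := fun x =>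
    isCompact_Icc.exists_bound_of_continuousOn (hf x).continuousOn
  choose C hC using h
  refine ⟨∑ x, |C x|, fun t ht x => (hC x t ht).trans ((le_abs_self _).trans ?_)⟩
  exact Finset.single_le_sum (f := fun x => |C x|) (fun _ _ => abs_nonneg _) (Finset.mem_univ x)

namespace IsRegular

variable {π : M.Policy}

theorem integral_purchase (hπ : M.IsRegular π) (τ : ℝ) (x : M.State) (e : ℝ)
    (f : Option (Fin n) → ℝ) :
    Integrable (fun p : unitInterval × unitInterval => f (M.purchase π τ x (e, p)))
      (volume.prod volume) ∧
    ∫ p : unitInterval × unitInterval, f (M.purchase π τ x (e, p)) ∂volume.prod volume =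
      ∑ S, π τ x S * ∑ o, M.choiceProb S o * f o := by
  have hm : Measurable fun p : unitInterval × unitInterval => f (M.purchase π τ x (e, p)) :=
    Measurable.of_discrete.comp
      ((hπ.measurable_purchase x).comp
        (f := fun p : unitInterval × unitInterval => (τ, ((e, p) : Noise))) (by fun_prop))
  have hi : Integrable (fun p : unitInterval × unitInterval => f (M.purchase π τ x (e, p)))
      (volume.prod volume) :=
    Integrable.of_bound hm.aestronglyMeasurable (∑ o, |f o|) (Filter.Eventually.of_forall fun p =>
      Finset.single_le_sum (f := fun o => |f o|) (fun _ _ => abs_nonneg _) (Finset.mem_univ _))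
  refine ⟨hi, ?_⟩
  rw [integral_prod _ hi]
  simp only [purchase]
  simp_rw [integral_sample (M.choiceProb_nonneg _) (M.choiceProb_sum _)]
  exact integral_sample (hπ.nonneg τ x) (hπ.sum_eq_one τ x)
    fun S => ∑ o, M.choiceProb S o * f o

theorem continuous_meanNext (hπ : M.IsRegular π) {w : ℝ → M.State → ℝ}
    (hw : ∀ x, Continuous fun t => w t x) (x : M.State) :
    Continuous fun t => M.meanNext π w t x := by
  unfold meanNext
  exact continuous_finsetSum _ fun S _ => (hπ.continuous x S).mul
    (continuous_finsetSum _ fun o _ => continuous_const.mul (continuous_const.add (hw _)))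

theorem integrable_arrivalStep (hπ : M.IsRegular π) {h w : ℝ → M.State → ℝ}
    (hh : ∀ x, Continuous fun t => h t x) (hw : ∀ x, Continuous fun t => w t x) {t : ℝ}
    (ht : t ∈ Icc 0 M.T) (x : M.State) : Integrable (M.arrivalStep h π w t x) M.noiseLaw := by
  have hτ : Measurable fun z : Noise => t + z.1 := by fun_prop
  have hp : Measurable fun z : Noise => M.purchase π (t + z.1) x z :=
    (hπ.measurable_purchase x).comp (hτ.prodMk measurable_id)
  have hm : Measurable (M.arrivalStep h π w t x) := by
    refine Measurable.ite (hτ measurableSet_Ioc) ?_ measurable_const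
    refine Measurable.add ?_ (Measurable.add ?_ ?_)
    · exact (intervalIntegral.continuous_primitive
        (fun a b => (hh x).intervalIntegrable a b) t).measurable.comp hτ
    · exact (Measurable.of_discrete (f := M.revenue)).comp hp
    · exact measurable_apply_countable (f := fun o (z : Noise) => w (t + z.1) (M.sell x o))
        (fun o => (hw _).measurable.comp hτ) hp
  obtain ⟨Ch, hCh⟩ := M.exists_abs_le_of_continuous hh
  obtain ⟨Cw, hCw⟩ := M.exists_abs_le_of_continuous hw
  have hCh0 : 0 ≤ Ch := (abs_nonneg _).trans (hCh t ht x)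
  have hCw0 : 0 ≤ Cw := (abs_nonneg _).trans (hCw t ht x)
  have hI : ∀ b ∈ Icc t M.T, |∫ s in t..b, h s x| ≤ Ch * M.T := fun b hb => by
    have h1 : ∀ s ∈ uIoc t b, ‖h s x‖ ≤ Ch := fun s hs => by
      rw [uIoc_of_le hb.1] at hs
      exact hCh s ⟨ht.1.trans hs.1.le, hs.2.trans hb.2⟩ x
    refine (intervalIntegral.norm_integral_le_of_norm_le_const h1).trans ?_
    rw [abs_of_nonneg (sub_nonneg.2 hb.1)]
    exact mul_le_mul_of_nonneg_left (by linarith [ht.1, hb.2]) hCh0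
  refine Integrable.of_bound hm.aestronglyMeasurable (Ch * M.T + (∑ o, |M.revenue o| + Cw))
    (Filter.Eventually.of_forall fun z => ?_)
  have hR : ∀ o, |M.revenue o| ≤ ∑ o, |M.revenue o| := fun o =>
    Finset.single_le_sum (f := fun o => |M.revenue o|) (fun _ _ => abs_nonneg _) (Finset.mem_univ _)
  have hR0 : 0 ≤ ∑ o, |M.revenue o| := Finset.sum_nonneg fun _ _ => abs_nonneg _
  rw [Real.norm_eq_abs]
  unfold arrivalStep
  split_ifs with hz
  · refine (abs_add_le _ _).trans (add_le_add (hI _ ⟨hz.1.le, hz.2⟩) ?_)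
    exact (abs_add_le _ _).trans (add_le_add (hR _) (hCw _ ⟨ht.1.trans hz.1.le, hz.2⟩ _))
  · exact (hI _ ⟨ht.2, le_rfl⟩).trans (by linarith)

/-- The expectation over the noise of the first customer, with the assortment and the choice
integrated out. -/
theorem integral_arrivalStep (hπ : M.IsRegular π) {h w : ℝ → M.State → ℝ}
    (hh : ∀ x, Continuous fun t => h t x) (hw : ∀ x, Continuous fun t => w t x) {t : ℝ}
    (ht : t ∈ Icc 0 M.T) (x : M.State) :
    ∫ z, M.arrivalStep h π w t x z ∂M.noiseLaw =
      (∫ e in 0..M.T - t, M.rate * Real.exp (-(M.rate * e)) *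
        ((∫ s in t..t + e, h s x) + M.meanNext π w (t + e) x)) +
      Real.exp (-(M.rate * (M.T - t))) * ∫ s in t..M.T, h s x := by
  classical
  have hint := hπ.integrable_arrivalStep hh hw ht x
  have hprob := isProbabilityMeasure_expMeasure M.rate_pos
  rw [noiseLaw] at hint ⊢
  rw [integral_prod _ hint]
  have hmem : ∀ e, t + e ∈ Ioc t M.T ↔ e ∈ Ioc 0 (M.T - t) := fun e => by
    simp only [mem_Ioc]
    constructor <;> rintro ⟨h1, h2⟩ <;> constructor <;> linarith
  have hinner : ∀ e, ∫ p : unitInterval × unitInterval, M.arrivalStep h π w t x (e, p)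
        ∂volume.prod volume =
      if e ∈ Ioc 0 (M.T - t) then (∫ s in t..t + e, h s x) + M.meanNext π w (t + e) x
      else ∫ s in t..M.T, h s x := fun e => by
    simp only [arrivalStep, hmem]
    split_ifs with he
    · have h1 := hπ.integral_purchase (t + e) x e fun o => M.revenue o + w (t + e) (M.sell x o)
      rw [integral_add (integrable_const _) h1.1, h1.2, meanNext]
      simp
    · simp
  simp_rw [hinner]
  have h1 : Continuous fun e => ∫ s in t..t + e, h s x :=
    (intervalIntegral.continuous_primitive
      (fun a b => (hh x).intervalIntegrable a b) t).comp (continuous_const_add t)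
  have h2 := (hπ.continuous_meanNext hw x).comp (continuous_const_add t)
  convert integral_expMeasure_ite M.rate_pos (sub_nonneg.2 ht.2)
    (fun e => (∫ s in t..t + e, h s x) + M.meanNext π w (t + e) x) (∫ s in t..M.T, h s x)
    (Continuous.intervalIntegrable (Continuous.mul (by fun_prop) (h1.add h2)) _ _) using 1

/-- If `w` solves the linear backward equation of the policy `π` with running reward `h`, then it
satisfies the corresponding renewal equation. -/
theorem eq_integral_arrivalStep (hπ : M.IsRegular π) {h w : ℝ → M.State → ℝ}
    (hh : ∀ x, Continuous fun t => h t x) (hw : ∀ x, Continuous fun t => w t x)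
    (hd : ∀ t ∈ Ioo 0 M.T, ∀ x, HasDerivAt (fun s => w s x)
      (M.rate * (w t x - M.meanNext π w t x) - h t x) t)
    (hT : ∀ x, w M.T x = 0) {t : ℝ} (ht : t ∈ Icc 0 M.T) (x : M.State) :
    w t x = ∫ z, M.arrivalStep h π w t x z ∂M.noiseLaw := by
  rw [hπ.integral_arrivalStep hh hw ht x]
  have hprim : Continuous fun e => ∫ s in t..t + e, h s x :=
    (intervalIntegral.continuous_primitive
      (fun a b => (hh x).intervalIntegrable a b) t).comp (continuous_const_add t)
  have hmean := (hπ.continuous_meanNext hw x).comp (continuous_const_add t)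
  have hwc := (hw x).comp (continuous_const_add t)
  -- Minus the discounted sum of `w` and the accumulated running reward is a primitive of the
  -- integrand.
  have key := intervalIntegral.integral_eq_sub_of_hasDerivAt_of_le (sub_nonneg.2 ht.2)
    (f := fun e => -(Real.exp (-(M.rate * e)) * (w (t + e) x + ∫ s in t..t + e, h s x)))
    (f' := fun e => M.rate * Real.exp (-(M.rate * e)) *
        ((∫ s in t..t + e, h s x) + M.meanNext π w (t + e) x)) ?_ ?_ ?_
  · rw [key]
    simp [hT]
  · refine Continuous.continuousOn (Continuous.neg (Continuous.mul (by fun_prop) ?_))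
    exact hwc.add hprim
  · intro e he
    have h1 : HasDerivAt (fun e => Real.exp (-(M.rate * e)))
        (Real.exp (-(M.rate * e)) * -(M.rate * 1)) e :=
      ((hasDerivAt_id e).const_mul M.rate).neg.exp
    have h2 : HasDerivAt (fun e => w (t + e) x) _ e :=
      (hd (t + e) ⟨by linarith [ht.1, he.1], by linarith [he.2]⟩ x).comp_const_add t e
    have h3 : HasDerivAt (fun e => ∫ s in t..t + e, h s x) (h (t + e) x) e :=
      (intervalIntegral.integral_hasDerivAt_right ((hh x).intervalIntegrable _ _)
        ((hh x).stronglyMeasurableAtFilter _ _) (hh x).continuousAt).comp_const_add t e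
    exact (h1.mul (h2.add h3)).neg.congr_deriv (by rw [Pi.add_apply]; ring)
  · exact Continuous.intervalIntegrable
      (Continuous.mul (by fun_prop) (hprim.add hmean)) _ _

end IsRegular

end NRM

/-! ### The Gibbs variational identity -/

/-- The Gibbs variational identity: the free energy exceeds the entropy-regularized expectation of
`H` under a probability vector `p` by `γ` times the relative entropy of `p` with respect to the
Boltzmann distribution. -/
theorem sum_add_klFun_eq_log_sum_exp {α : Type*} {F : Finset α} (hF : F.Nonempty) {H p : α → ℝ}
    {γ : ℝ} (hγ : 0 < γ) (hp1 : ∑ a ∈ F, p a = 1) :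
    ∑ a ∈ F, (H a - γ * Real.log (p a)) * p a +
      γ * ∑ a ∈ F, Real.exp (H a / γ) / (∑ b ∈ F, Real.exp (H b / γ)) *
        InformationTheory.klFun (p a / (Real.exp (H a / γ) / ∑ b ∈ F, Real.exp (H b / γ))) =
    γ * Real.log (∑ a ∈ F, Real.exp (H a / γ)) := by
  set Z := ∑ a ∈ F, Real.exp (H a / γ) with hZ
  have hZ0 : 0 < Z := Finset.sum_pos (fun a _ => Real.exp_pos _) hF
  have hterm : ∀ a, (H a - γ * Real.log (p a)) * p a +
      γ * (Real.exp (H a / γ) / Z * InformationTheory.klFun (p a / (Real.exp (H a / γ) / Z))) =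
      γ * Real.log Z * p a + γ * (Real.exp (H a / γ) / Z - p a) := fun a => by
    have hb : 0 < Real.exp (H a / γ) / Z := by positivity
    have hlog : p a * Real.log (p a / (Real.exp (H a / γ) / Z)) =
        p a * (Real.log (p a) - H a / γ + Real.log Z) := by
      rcases eq_or_ne (p a) 0 with h | h
      · simp [h]
      · rw [Real.log_div h hb.ne', Real.log_div (Real.exp_pos _).ne' hZ0.ne', Real.log_exp]
        ring
    have hkl : Real.exp (H a / γ) / Z * InformationTheory.klFun (p a / (Real.exp (H a / γ) / Z)) =
        p a * Real.log (p a / (Real.exp (H a / γ) / Z)) + Real.exp (H a / γ) / Z - p a := by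
      rw [InformationTheory.klFun_apply]
      generalize Real.log (p a / (Real.exp (H a / γ) / Z)) = L
      field_simp
    rw [hkl, hlog]
    field_simp
    ring
  have hb1 : ∑ a ∈ F, Real.exp (H a / γ) / Z = 1 := by
    rw [← Finset.sum_div, ← hZ, div_self hZ0.ne']
  rw [Finset.mul_sum, ← Finset.sum_add_distrib, Finset.sum_congr rfl fun a _ => hterm a,
    Finset.sum_add_distrib, ← Finset.mul_sum, ← Finset.mul_sum, Finset.sum_sub_distrib, hp1, hb1]
  ring

namespace NRM

variable {m n : ℕ} {M : NRM m n}

/-! ### The Hamiltonian and the free energy -/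

/-- The expected revenue from a customer who is offered `S` in state `x`, plus the expectation of
the function `u` of the state after that customer. -/
def meanAfter (M : NRM m n) (u : M.State → ℝ) (x : M.State) (S : Finset (Fin n)) : ℝ :=
  ∑ o, M.choiceProb S o * (M.revenue o + u (M.sell x o))

/-- For a feasible assortment the product `j` leads to exactly one state, `sell x (some j)`, and
this state differs from `x`, so that the transition rates can be summed over products. -/
theorem hamiltonian_eq {x : M.State} {S : Finset (Fin n)} (hS : S ∈ M.feasible x)
    (v : ℝ → M.State → ℝ) (t : ℝ) :
    M.hamiltonian v t x S = M.rate * (M.meanAfter (v t) x S - v t x) := by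
  have hS' := (Finset.mem_filter.1 hS).2
  have hq : ∀ y, M.transitionRate y x S =
      (if y = x then -(M.rate * (1 - M.choiceProb S none)) else 0) +
        ∑ j, if y = M.sell x (some j) then M.rate * M.choiceProb S (some j) else 0 := fun y => by
    have hcond : ∀ j ∈ S, (∀ i, (y i : ℕ) + M.A i j = (x i : ℕ)) ↔ y = M.sell x (some j) := by
      intro j hj
      have hA := hS' j hj
      simp only [funext_iff, sell, Fin.ext_iff]
      exact forall_congr' fun i => by have := hA i; omega
    have hsell : ∀ j ∈ S, M.sell x (some j) ≠ x := fun j hj h => by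
      obtain ⟨i, hi⟩ := M.A_ne_zero j
      have h1 := congrArg Fin.val (congrFun h i)
      have h2 := hS' j hj i
      simp only [sell] at h1
      omega
    rw [transitionRate]
    split_ifs with hy
    · rw [Finset.sum_eq_zero fun j _ => ?_, add_zero]
      by_cases hj : j ∈ S
      · rw [if_neg fun h => hsell j hj (h.symm.trans hy)]
      · simp [M.choiceProb_notMem S j hj]
    · rw [zero_add, Finset.sum_filter]
      refine Finset.sum_congr rfl fun j _ => ?_
      by_cases hj : j ∈ S
      · simp only [hcond j hj]
      · simp [M.choiceProb_notMem S j hj]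
  have hsum := M.choiceProb_sum S
  rw [Fintype.sum_option] at hsum
  have h1 : ∑ y, v t y * M.transitionRate y x S =
      v t x * -(M.rate * (1 - M.choiceProb S none)) +
        ∑ j, v t (M.sell x (some j)) * (M.rate * M.choiceProb S (some j)) := by
    simp_rw [hq, mul_add, Finset.sum_add_distrib, Finset.mul_sum]
    rw [Finset.sum_comm]
    simp
  rw [hamiltonian, h1, revenueRate, meanAfter, Fintype.sum_option]
  simp only [revenue, sell, Option.elim_none, Option.elim_some, mul_add, Finset.sum_add_distrib,
    mul_sub, Finset.mul_sum]
  have e1 : ∀ j, M.rate * (M.price j * M.choiceProb S (some j)) =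
      M.rate * (M.choiceProb S (some j) * M.price j) := fun j => by ring
  have e2 : ∀ j, v t (fun i => ⟨(x i : ℕ) - M.A i j, by have := (x i).isLt; omega⟩) *
      (M.rate * M.choiceProb S (some j)) = M.rate * (M.choiceProb S (some j) *
        v t (fun i => ⟨(x i : ℕ) - M.A i j, by have := (x i).isLt; omega⟩)) := fun j => by ring
  simp only [e1, e2]
  ring

theorem empty_mem_feasible (x : M.State) : ∅ ∈ M.feasible x := by
  simp [feasible]

/-- The normalizing constant of the Boltzmann distribution on the log scale, `γ log Z`.  It is the
value of the supremum in the exploratory HJB equation. -/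
def freeEnergy (M : NRM m n) (v : ℝ → M.State → ℝ) (t : ℝ) (x : M.State) : ℝ :=
  M.temp * Real.log (∑ S ∈ M.feasible x, Real.exp (M.hamiltonian v t x S / M.temp))

theorem partition_pos (v : ℝ → M.State → ℝ) (t : ℝ) (x : M.State) :
    0 < ∑ S ∈ M.feasible x, Real.exp (M.hamiltonian v t x S / M.temp) :=
  Finset.sum_pos (fun _ _ => Real.exp_pos _) ⟨∅, empty_mem_feasible x⟩

theorem boltzmann_pos (v : ℝ → M.State → ℝ) (t : ℝ) {x : M.State} {S : Finset (Fin n)}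
    (hS : S ∈ M.feasible x) : 0 < M.boltzmann v t x S := by
  rw [boltzmann, if_pos hS]
  exact div_pos (Real.exp_pos _) (partition_pos v t x)

theorem boltzmann_nonneg (v : ℝ → M.State → ℝ) (t : ℝ) (x : M.State) (S : Finset (Fin n)) :
    0 ≤ M.boltzmann v t x S := by
  by_cases hS : S ∈ M.feasible x
  · exact (boltzmann_pos v t hS).le
  · rw [boltzmann, if_neg hS]

theorem boltzmann_eq_zero (v : ℝ → M.State → ℝ) (t : ℝ) {x : M.State} {S : Finset (Fin n)}
    (hS : S ∉ M.feasible x) : M.boltzmann v t x S = 0 := by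
  rw [boltzmann, if_neg hS]

theorem boltzmann_sum (v : ℝ → M.State → ℝ) (t : ℝ) (x : M.State) :
    ∑ S, M.boltzmann v t x S = 1 := by
  simp only [boltzmann]
  rw [Finset.sum_ite_mem, Finset.univ_inter, ← Finset.sum_div, div_self (partition_pos v t x).ne']

theorem continuousOn_hamiltonian {v : ℝ → M.State → ℝ} {I : Set ℝ}
    (hv : ∀ x, ContinuousOn (fun t => v t x) I) (x : M.State) (S : Finset (Fin n)) :
    ContinuousOn (fun t => M.hamiltonian v t x S) I :=
  continuousOn_const.add (continuousOn_finsetSum _ fun y _ => (hv y).mul continuousOn_const)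

theorem continuousOn_boltzmann {v : ℝ → M.State → ℝ} {I : Set ℝ}
    (hv : ∀ x, ContinuousOn (fun t => v t x) I) (x : M.State) (S : Finset (Fin n)) :
    ContinuousOn (fun t => M.boltzmann v t x S) I := by
  have h : ∀ S, ContinuousOn (fun t => Real.exp (M.hamiltonian v t x S / M.temp)) I := fun S =>
    ((continuousOn_hamiltonian hv x S).div_const _).rexp
  unfold boltzmann
  split_ifs
  · exact (h S).div (continuousOn_finsetSum _ fun S _ => h S) fun t _ => (partition_pos v t x).ne'
  · exact continuousOn_const

theorem isRegular_boltzmann {v : ℝ → M.State → ℝ} (hv : ∀ x, Continuous fun t => v t x) :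
    M.IsRegular (M.boltzmann v) where
  nonneg := boltzmann_nonneg v
  sum_eq_one := boltzmann_sum v
  eq_zero t _ _ hS := boltzmann_eq_zero v t hS
  continuous x S := continuousOn_univ.1
    (continuousOn_boltzmann (fun x => (hv x).continuousOn) x S)

theorem isAdmissible_boltzmann {v : ℝ → M.State → ℝ}
    (hv : ∀ x, ContinuousOn (fun t => v t x) (Icc 0 M.T)) : M.IsAdmissible (M.boltzmann v) where
  measurable x S := (continuousOn_boltzmann hv x S).domRestrict.measurable
  nonneg t _ := boltzmann_nonneg v t
  sum_eq_one t _ := boltzmann_sum v t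
  eq_zero t _ _ _ hS := boltzmann_eq_zero v t hS
  continuousOn := continuousOn_boltzmann hv

theorem boltzmann_congr {v v' : ℝ → M.State → ℝ} {t : ℝ} (h : v t = v' t) :
    M.boltzmann v t = M.boltzmann v' t := by
  unfold boltzmann hamiltonian
  rw [h]

theorem freeEnergy_congr {v v' : ℝ → M.State → ℝ} {t : ℝ} (h : v t = v' t) :
    M.freeEnergy v t = M.freeEnergy v' t := by
  unfold freeEnergy hamiltonian
  rw [h]

/-- The loss rate of a policy against the Boltzmann policy: the temperature times the relative
entropy of `π(· | t, x)` with respect to the Boltzmann distribution. -/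
def gap (M : NRM m n) (v : ℝ → M.State → ℝ) (π : M.Policy) (t : ℝ) (x : M.State) : ℝ :=
  M.temp * ∑ S ∈ M.feasible x, M.boltzmann v t x S *
    InformationTheory.klFun (π t x S / M.boltzmann v t x S)

theorem gap_boltzmann (v : ℝ → M.State → ℝ) (t : ℝ) (x : M.State) :
    M.gap v (M.boltzmann v) t x = 0 := by
  rw [gap, Finset.sum_eq_zero fun S hS => ?_, mul_zero]
  rw [div_self (boltzmann_pos v t hS).ne', InformationTheory.klFun_one, mul_zero]

namespace IsRegular

variable {π : M.Policy}

theorem sum_feasible_eq (hπ : M.IsRegular π) (t : ℝ) (x : M.State) (f : Finset (Fin n) → ℝ) :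
    ∑ S ∈ M.feasible x, π t x S * f S = ∑ S, π t x S * f S :=
  Finset.sum_subset (Finset.subset_univ _) fun S _ hS => by rw [hπ.eq_zero t x S hS, zero_mul]

theorem gap_nonneg (hπ : M.IsRegular π) (v : ℝ → M.State → ℝ) (t : ℝ) (x : M.State) :
    0 ≤ M.gap v π t x :=
  mul_nonneg M.temp_pos.le (Finset.sum_nonneg fun S _ => mul_nonneg (boltzmann_nonneg v t x S)
    (InformationTheory.klFun_nonneg (div_nonneg (hπ.nonneg t x S) (boltzmann_nonneg v t x S))))

theorem eq_boltzmann_of_gap_eq_zero (hπ : M.IsRegular π) {v : ℝ → M.State → ℝ} {t : ℝ}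
    {x : M.State} (h : M.gap v π t x = 0) (S : Finset (Fin n)) : π t x S = M.boltzmann v t x S := by
  by_cases hS : S ∈ M.feasible x
  · have hkl : ∀ S, 0 ≤ InformationTheory.klFun (π t x S / M.boltzmann v t x S) := fun S =>
      InformationTheory.klFun_nonneg (div_nonneg (hπ.nonneg t x S) (boltzmann_nonneg v t x S))
    have h1 := (mul_eq_zero.1 h).resolve_left M.temp_pos.ne'
    rw [Finset.sum_eq_zero_iff_of_nonneg fun S _ =>
      mul_nonneg (boltzmann_nonneg v t x S) (hkl S)] at h1
    have hb := boltzmann_pos v t hS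
    have h2 := (mul_eq_zero.1 (h1 S hS)).resolve_left hb.ne'
    rw [InformationTheory.klFun_eq_zero_iff (div_nonneg (hπ.nonneg t x S) hb.le)] at h2
    exact (div_eq_one_iff_eq hb.ne').1 h2
  · rw [hπ.eq_zero t x S hS, boltzmann_eq_zero v t hS]

theorem continuous_gap (hπ : M.IsRegular π) {v : ℝ → M.State → ℝ}
    (hv : ∀ x, Continuous fun t => v t x) (x : M.State) : Continuous fun t => M.gap v π t x := by
  refine continuous_const.mul (continuous_finsetSum _ fun S hS => ?_)
  have hb := (isRegular_boltzmann hv).continuous x S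
  exact hb.mul (InformationTheory.continuous_klFun.comp
    ((hπ.continuous x S).div hb fun t => (boltzmann_pos v t hS).ne'))

theorem sum_add_gap (hπ : M.IsRegular π) (v : ℝ → M.State → ℝ) (t : ℝ) (x : M.State) :
    ∑ S ∈ M.feasible x, (M.hamiltonian v t x S - M.temp * Real.log (π t x S)) * π t x S +
      M.gap v π t x = M.freeEnergy v t x := by
  have h1 : ∑ S ∈ M.feasible x, π t x S = 1 := by
    simpa [hπ.sum_eq_one t x] using hπ.sum_feasible_eq t x fun _ => 1
  rw [freeEnergy, ← sum_add_klFun_eq_log_sum_exp ⟨∅, empty_mem_feasible x⟩ M.temp_pos h1, gap]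
  congr 2
  exact Finset.sum_congr rfl fun S hS => by rw [boltzmann, if_pos hS]

/-- The free energy, expressed through the drift, the entropy and the loss rate of a policy. -/
theorem freeEnergy_eq (hπ : M.IsRegular π) (v : ℝ → M.State → ℝ) (t : ℝ) (x : M.State) :
    M.freeEnergy v t x = M.rate * (M.meanNext π v t x - v t x) +
      (M.temp * M.entropy π t x + M.gap v π t x) := by
  rw [← hπ.sum_add_gap v t x]
  have h1 : ∑ S ∈ M.feasible x, (M.hamiltonian v t x S - M.temp * Real.log (π t x S)) * π t x S =
      ∑ S ∈ M.feasible x, π t x S * (M.rate * (M.meanAfter (v t) x S - v t x)) +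
        M.temp * M.entropy π t x := by
    rw [entropy, mul_neg, ← sub_eq_add_neg, Finset.mul_sum, ← Finset.sum_sub_distrib]
    exact Finset.sum_congr rfl fun S hS => by rw [hamiltonian_eq hS]; ring
  have h2 : ∑ S, π t x S * (M.rate * (M.meanAfter (v t) x S - v t x)) =
      M.rate * (M.meanNext π v t x - v t x) := by
    calc _ = M.rate * (∑ S, π t x S * M.meanAfter (v t) x S - (∑ S, π t x S) * v t x) := by
          rw [Finset.sum_mul, ← Finset.sum_sub_distrib, Finset.mul_sum]
          exact Finset.sum_congr rfl fun S _ => by ring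
      _ = _ := by rw [hπ.sum_eq_one, one_mul]; rfl
  rw [h1, hπ.sum_feasible_eq, h2]
  ring

end IsRegular

/-! ### Comparison of the value of a policy with a solution of the HJB equation -/

/-- A payment of `C` in the event that no customer arrives in `(t, T]`. -/
theorem integral_no_arrival (M : NRM m n) {t : ℝ} (ht : t ≤ M.T) (C : ℝ) :
    Integrable (fun z : Noise =>
      open scoped Classical in if t + z.1 ∈ Ioc t M.T then 0 else C) M.noiseLaw ∧
    ∫ z : Noise, (open scoped Classical in if t + z.1 ∈ Ioc t M.T then 0 else C) ∂M.noiseLaw =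
      Real.exp (-(M.rate * (M.T - t))) * C := by
  classical
  have hprob := isProbabilityMeasure_expMeasure M.rate_pos
  constructor
  · have hτ : Measurable fun z : Noise => t + z.1 := by fun_prop
    refine Integrable.of_bound (Measurable.ite (hτ measurableSet_Ioc) measurable_const
      measurable_const).aestronglyMeasurable |C| (Filter.Eventually.of_forall fun z => ?_)
    split_ifs <;> simp
  · have hmem : ∀ e, t + e ∈ Ioc t M.T ↔ e ∈ Ioc 0 (M.T - t) := fun e => by
      simp only [mem_Ioc]
      constructor <;> rintro ⟨h1, h2⟩ <;> constructor <;> linarith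
    simp only [hmem]
    rw [noiseLaw, integral_fun_fst fun e => if e ∈ Ioc 0 (M.T - t) then (0 : ℝ) else C]
    have h := integral_expMeasure_ite M.rate_pos (sub_nonneg.2 ht) (fun _ => 0) C (by simp)
    simp only [mul_zero, intervalIntegral.integral_zero, zero_add] at h
    rw [probReal_univ, one_smul, ← h]

/-- A function on an index set that is bounded below is nonnegative if each of its lower bounds
`-D` can be improved to `-(q * D)` with a fixed `q < 1`. -/
theorem nonneg_of_lower_bound_contraction {ι : Type*} {f : ι → ℝ} {q C : ℝ} (hq0 : 0 ≤ q)
    (hq1 : q < 1) (hC0 : 0 ≤ C) (hC : ∀ i, -C ≤ f i)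
    (hstep : ∀ D, 0 ≤ D → (∀ i, -D ≤ f i) → ∀ i, -(q * D) ≤ f i) (i : ι) : 0 ≤ f i := by
  have h : ∀ k : ℕ, ∀ i, -(q ^ k * C) ≤ f i := fun k => by
    induction k with
    | zero => simpa using hC
    | succ k ih =>
      have := hstep _ (by positivity) ih
      simpa only [pow_succ', mul_assoc] using this
  have hlim : Filter.Tendsto (fun k : ℕ => -(q ^ k * C)) Filter.atTop (nhds 0) := by
    simpa using ((tendsto_pow_atTop_nhds_zero_of_lt_one hq0 hq1).mul_const C).neg
  exact le_of_tendsto' hlim fun k => h k i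

/-- A bounded function that satisfies a renewal inequality is nonnegative: as the next customer
fails to arrive before `T` with probability at least `exp (-λ T)`, lower bounds contract. -/
theorem nonneg_of_renewal {f : ℝ → M.State → ℝ} {K : ℝ → M.State → Noise → ℝ} {C : ℝ}
    (hC : ∀ t ∈ Icc 0 M.T, ∀ x, -C ≤ f t x)
    (hi : ∀ t ∈ Icc 0 M.T, ∀ x, Integrable (K t x) M.noiseLaw)
    (hf : ∀ t ∈ Icc 0 M.T, ∀ x, f t x = ∫ z, K t x z ∂M.noiseLaw)
    (hK : ∀ t ∈ Icc 0 M.T, ∀ x z, ∃ y, (t + z.1 ∈ Ioc t M.T → f (t + z.1) y ≤ K t x z) ∧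
      (t + z.1 ∉ Ioc t M.T → 0 ≤ K t x z)) :
    ∀ t ∈ Icc 0 M.T, ∀ x, 0 ≤ f t x := by
  have hexp : Real.exp (-(M.rate * M.T)) ≤ 1 :=
    Real.exp_le_one_iff.2 (neg_nonpos.2 (mul_nonneg M.rate_pos.le M.T_pos.le))
  have key : ∀ i : Icc 0 M.T × M.State, 0 ≤ f i.1 i.2 := by
    refine nonneg_of_lower_bound_contraction (q := 1 - Real.exp (-(M.rate * M.T))) (C := |C|)
      (by linarith) (by linarith [Real.exp_pos (-(M.rate * M.T))]) (abs_nonneg C)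
      (fun i => (neg_le_neg (le_abs_self C)).trans (hC _ i.1.2 _)) ?_
    rintro D hD hlow ⟨⟨t, ht⟩, x⟩
    change -((1 - Real.exp (-(M.rate * M.T))) * D) ≤ f t x
    have hno := M.integral_no_arrival ht.2 D
    have hle : ∫ z : Noise, (-D + open scoped Classical in if t + z.1 ∈ Ioc t M.T then 0 else D)
        ∂M.noiseLaw ≤ ∫ z, K t x z ∂M.noiseLaw := by
      refine integral_mono ((integrable_const _).add hno.1) (hi t ht x) fun z => ?_
      obtain ⟨y, hy1, hy2⟩ := hK t ht x z
      beta_reduce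
      split_ifs with hz
      · rw [add_zero]
        exact (hlow (⟨t + z.1, ht.1.trans hz.1.le, hz.2⟩, y)).trans (hy1 hz)
      · rw [neg_add_cancel]
        exact hy2 hz
    rw [integral_add (integrable_const _) hno.1, hno.2, integral_const, probReal_univ, one_smul,
      ← hf t ht x] at hle
    have hmono : Real.exp (-(M.rate * M.T)) ≤ Real.exp (-(M.rate * (M.T - t))) :=
      Real.exp_le_exp.2 (neg_le_neg (mul_le_mul_of_nonneg_left (by linarith [ht.1]) M.rate_pos.le))
    nlinarith [mul_le_mul_of_nonneg_right hmono hD]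
  exact fun t ht x => key (⟨t, ht⟩, x)

/-- Solutions of the HJB equation, with the supremum evaluated as the free energy, and extended
continuously to all times. -/
structure IsClassicalSolution (M : NRM m n) (w : ℝ → M.State → ℝ) : Prop where
  continuous : ∀ x, Continuous fun t => w t x
  hasDerivAt : ∀ t ∈ Ioo 0 M.T, ∀ x, HasDerivAt (fun s => w s x) (-M.freeEnergy w t x) t
  terminal : ∀ x, w M.T x = 0

namespace IsClassicalSolution

variable {w : ℝ → M.State → ℝ} {π : M.Policy}

/-- The renewal equation for the difference between a solution of the HJB equation and the value of
a policy, with the loss rate of the policy as running reward. -/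
theorem sub_value_eq (hw : M.IsClassicalSolution w) (hπ : M.IsRegular π) :
    ∃ K : ℝ → M.State → Noise → ℝ,
      (∀ t ∈ Icc 0 M.T, ∀ x, Integrable (K t x) M.noiseLaw) ∧
      (∀ t ∈ Icc 0 M.T, ∀ x, w t x - M.value π t x = ∫ z, K t x z ∂M.noiseLaw) ∧
      ∀ t x z, (t + z.1 ∈ Ioc t M.T → ∃ y, K t x z =
          (∫ s in t..t + z.1, M.gap w π s x) + (w (t + z.1) y - M.value π (t + z.1) y)) ∧
        (t + z.1 ∉ Ioc t M.T → K t x z = ∫ s in t..M.T, M.gap w π s x) := by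
  have hent : ∀ x, Continuous fun t => M.temp * M.entropy π t x := fun x =>
    continuous_const.mul (hπ.continuous_entropy x)
  have hgap := hπ.continuous_gap hw.continuous
  have hh : ∀ x, Continuous fun t => M.temp * M.entropy π t x + M.gap w π t x := fun x =>
    (hent x).add (hgap x)
  have hint : ∀ x a b, ∫ s in a..b, (M.temp * M.entropy π s x + M.gap w π s x) =
      (∫ s in a..b, M.temp * M.entropy π s x) + ∫ s in a..b, M.gap w π s x := fun x a b =>
    intervalIntegral.integral_add ((hent x).intervalIntegrable _ _)
      ((hgap x).intervalIntegrable _ _)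
  have hver : ∀ t ∈ Icc 0 M.T, ∀ x, w t x = ∫ z, M.arrivalStep
      (fun s y => M.temp * M.entropy π s y + M.gap w π s y) π w t x z ∂M.noiseLaw :=
    fun t ht x => hπ.eq_integral_arrivalStep hh hw.continuous (fun t ht x =>
      (hw.hasDerivAt t ht x).congr_deriv (by rw [hπ.freeEnergy_eq]; ring)) hw.terminal ht x
  refine ⟨fun t x z =>
    M.arrivalStep (fun s y => M.temp * M.entropy π s y + M.gap w π s y) π w t x z -
    M.arrivalStep (fun s y => M.temp * M.entropy π s y) π (M.value π) t x z,
    fun t ht x => (hπ.integrable_arrivalStep hh hw.continuous ht x).sub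
      (hπ.value_eq_integral ht x).1, fun t ht x => ?_, fun t x z => ⟨fun hz => ?_, fun hz => ?_⟩⟩
  · rw [integral_sub (hπ.integrable_arrivalStep hh hw.continuous ht x)
      (hπ.value_eq_integral ht x).1, ← hver t ht x, ← (hπ.value_eq_integral ht x).2]
  · refine ⟨M.sell x (M.purchase π (t + z.1) x z), ?_⟩
    simp only [arrivalStep, if_pos hz, hint]
    ring
  · simp only [arrivalStep, if_neg hz, hint]
    ring

theorem exists_abs_sub_value_le (hw : M.IsClassicalSolution w) (hπ : M.IsRegular π) :
    ∃ C, ∀ t ∈ Icc 0 M.T, ∀ x, |w t x - M.value π t x| ≤ C := by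
  obtain ⟨C, hC⟩ := hπ.exists_abs_value_le
  obtain ⟨C', hC'⟩ := M.exists_abs_le_of_continuous hw.continuous
  exact ⟨C' + C, fun t ht x => (abs_sub _ _).trans (add_le_add (hC' t ht x) (hC t ht x))⟩

theorem value_le (hw : M.IsClassicalSolution w) (hπ : M.IsRegular π) :
    ∀ t ∈ Icc 0 M.T, ∀ x, M.value π t x ≤ w t x := by
  obtain ⟨K, hKi, hK, hKz⟩ := hw.sub_value_eq hπ
  obtain ⟨C, hC⟩ := hw.exists_abs_sub_value_le hπ
  have hpos : ∀ x a b, a ≤ b → 0 ≤ ∫ s in a..b, M.gap w π s x := fun x a b hab =>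
    intervalIntegral.integral_nonneg hab fun s _ => hπ.gap_nonneg w s x
  have := nonneg_of_renewal (f := fun t x => w t x - M.value π t x) (C := C)
    (fun t ht x => (abs_le.1 (hC t ht x)).1) hKi hK fun t ht x z => ?_
  · exact fun t ht x => sub_nonneg.1 (this t ht x)
  · by_cases hz : t + z.1 ∈ Ioc t M.T
    · obtain ⟨y, hy⟩ := (hKz t x z).1 hz
      exact ⟨y, fun _ => by linarith [hpos x _ _ hz.1.le], fun h => absurd hz h⟩
    · exact ⟨x, fun h => absurd h hz, fun _ => by rw [(hKz t x z).2 hz]; exact hpos x _ _ ht.2⟩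

theorem value_boltzmann (hw : M.IsClassicalSolution w) :
    ∀ t ∈ Icc 0 M.T, ∀ x, M.value (M.boltzmann w) t x = w t x := by
  have hπ := isRegular_boltzmann hw.continuous
  obtain ⟨K, hKi, hK, hKz⟩ := hw.sub_value_eq hπ
  obtain ⟨C, hC⟩ := hw.exists_abs_sub_value_le hπ
  simp only [gap_boltzmann, intervalIntegral.integral_zero, zero_add] at hKz
  have := nonneg_of_renewal (f := fun t x => -(w t x - M.value (M.boltzmann w) t x)) (C := C)
    (fun t ht x => neg_le_neg (abs_le.1 (hC t ht x)).2) (fun t ht x => (hKi t ht x).neg)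
    (fun t ht x => by simp only [Pi.neg_apply, integral_neg, hK t ht x]) fun t ht x z => ?_
  · exact fun t ht x => le_antisymm (hw.value_le hπ t ht x)
      (by linarith [this t ht x])
  · by_cases hz : t + z.1 ∈ Ioc t M.T
    · obtain ⟨y, hy⟩ := (hKz t x z).1 hz
      exact ⟨y, fun _ => by rw [Pi.neg_apply, hy], fun h => absurd hz h⟩
    · exact ⟨x, fun h => absurd h hz, fun _ => by rw [Pi.neg_apply, (hKz t x z).2 hz, neg_zero]⟩

/-- A policy that attains the solution of the HJB equation has loss rate zero: with positive
probability no customer arrives, and then the whole integral of the loss rate is lost. -/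
theorem eq_boltzmann_of_value_eq (hw : M.IsClassicalSolution w) (hπ : M.IsRegular π)
    (h : ∀ t ∈ Icc 0 M.T, ∀ x, M.value π t x = w t x) :
    ∀ t ∈ Icc 0 M.T, ∀ x S, π t x S = M.boltzmann w t x S := by
  obtain ⟨K, hKi, hK, hKz⟩ := hw.sub_value_eq hπ
  intro t ht x S
  refine hπ.eq_boltzmann_of_gap_eq_zero ?_ S
  by_contra hne
  have hpos : 0 < ∫ s in 0..M.T, M.gap w π s x :=
    intervalIntegral.integral_pos M.T_pos (hπ.continuous_gap hw.continuous x).continuousOn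
      (fun s _ => hπ.gap_nonneg w s x) ⟨t, ht, (hπ.gap_nonneg w t x).lt_of_ne' hne⟩
  have h0 := M.zero_mem_horizon
  have hno := M.integral_no_arrival h0.2 (∫ s in 0..M.T, M.gap w π s x)
  have hle : ∫ z : Noise, (open scoped Classical in
      if 0 + z.1 ∈ Ioc 0 M.T then 0 else ∫ s in 0..M.T, M.gap w π s x) ∂M.noiseLaw ≤
      ∫ z, K 0 x z ∂M.noiseLaw := by
    refine integral_mono hno.1 (hKi 0 h0 x) fun z => ?_
    beta_reduce
    split_ifs with hz
    · obtain ⟨y, hy⟩ := (hKz 0 x z).1 hz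
      rw [hy, h _ (Ioc_subset_Icc_self hz), sub_self, add_zero]
      exact intervalIntegral.integral_nonneg hz.1.le fun s _ => hπ.gap_nonneg w s x
    · rw [(hKz 0 x z).2 hz]
  rw [hno.2, ← hK 0 h0, h 0 h0, sub_self] at hle
  exact absurd hle (not_le.2 (mul_pos (Real.exp_pos _) hpos))

theorem isGreatest_value (hw : M.IsClassicalSolution w) {t : ℝ} (ht : t ∈ Icc 0 M.T)
    (x : M.State) :
    IsGreatest {a : ℝ | ∃ π, M.IsAdmissible π ∧ a = M.value π t x} (w t x) := by
  refine ⟨⟨M.boltzmann w, isAdmissible_boltzmann fun x => (hw.continuous x).continuousOn,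
    (hw.value_boltzmann t ht x).symm⟩, ?_⟩
  rintro _ ⟨π, hπ, rfl⟩
  rw [value_congr (eq_comp_clamp π) ht]
  exact hw.value_le hπ.isRegular_clamp t ht x

theorem eq_optValue (hw : M.IsClassicalSolution w) {t : ℝ} (ht : t ∈ Icc 0 M.T) (x : M.State) :
    w t x = M.optValue t x := by
  rw [← (hw.isGreatest_value ht x).csSup_eq, optValue, iSup]
  congr 1
  ext a
  constructor
  · rintro ⟨π, hπ, rfl⟩
    exact ⟨⟨π, hπ⟩, rfl⟩
  · rintro ⟨π, rfl⟩
    exact ⟨π.1, π.2, rfl⟩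

end IsClassicalSolution

/-! ### The supremum in the HJB equation -/

/-- The supremum in the HJB equation is the free energy, attained by the Boltzmann policy. -/
theorem isGreatest_freeEnergy {v : ℝ → M.State → ℝ}
    (hv : ∀ x, ContinuousOn (fun t => v t x) (Icc 0 M.T)) {t : ℝ} (ht : t ∈ Icc 0 M.T)
    (x : M.State) :
    IsGreatest {a : ℝ | ∃ π : M.Policy, M.IsAdmissible π ∧
      a = ∑ S ∈ M.feasible x,
        (M.hamiltonian v t x S - M.temp * Real.log (π t x S)) * π t x S}
      (M.freeEnergy v t x) := by
  have h : ∀ π, M.IsAdmissible π → ∑ S ∈ M.feasible x,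
      (M.hamiltonian v t x S - M.temp * Real.log (π t x S)) * π t x S + M.gap v π t x =
        M.freeEnergy v t x := fun π hπ => by
    have := hπ.isRegular_clamp.sum_add_gap v t x
    simpa only [gap, clamp_of_mem ht] using this
  refine ⟨⟨M.boltzmann v, isAdmissible_boltzmann hv, ?_⟩, ?_⟩
  · rw [← h _ (isAdmissible_boltzmann hv), gap_boltzmann, add_zero]
  · rintro _ ⟨π, hπ, rfl⟩
    have h1 := hπ.isRegular_clamp.gap_nonneg v t x
    simp only [gap, clamp_of_mem ht] at h1
    rw [← h π hπ]
    exact le_add_of_nonneg_right h1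

/-- Solutions of the HJB equation are extended to all times by composition with `clamp`. -/
theorem SolvesHJB.isClassicalSolution {v : ℝ → M.State → ℝ} (hv : M.IsC10 v)
    (hs : M.SolvesHJB v) : M.IsClassicalSolution fun t => v (M.clamp t) where
  continuous x := continuous_comp_clamp (hv x).continuousOn
  hasDerivAt t ht x := by
    have ht' := Ioo_subset_Icc_self ht
    have hnhds : Icc 0 M.T ∈ nhds t := Icc_mem_nhds ht.1 ht.2
    have h1 := (isGreatest_freeEnergy (fun x => (hv x).continuousOn) ht' x).isLUB.unique
      (hs.isLUB t ⟨ht.1.le, ht.2⟩ x)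
    have h2 : HasDerivAt (fun s => v s x) (-M.freeEnergy v t x) t := by
      rw [h1, neg_neg]
      exact (((hv x).differentiableOn one_ne_zero) t ht').hasDerivWithinAt.hasDerivAt hnhds
    rw [freeEnergy_congr (v := fun t => v (M.clamp t)) (v' := v) (by rw [clamp_of_mem ht'])]
    refine h2.congr_of_eventuallyEq ?_
    filter_upwards [hnhds] with s hs
    rw [clamp_of_mem hs]
  terminal x := by rw [clamp_of_mem ⟨M.T_pos.le, le_rfl⟩, hs.terminal]

/-! ### Existence of a solution of the HJB equation -/

/-- The part `u ↦ γ log ∑_S exp (λ meanAfter u x S / γ)` of the free energy that remains after the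
term `-λ u x` has been split off. -/
def softmaxNext (M : NRM m n) (u : M.State → ℝ) (x : M.State) : ℝ :=
  M.temp * Real.log (∑ S ∈ M.feasible x, Real.exp (M.rate * M.meanAfter u x S / M.temp))

theorem freeEnergy_eq_softmaxNext (v : ℝ → M.State → ℝ) (t : ℝ) (x : M.State) :
    M.freeEnergy v t x = M.softmaxNext (v t) x - M.rate * v t x := by
  have hγ := M.temp_pos
  have h : ∀ S ∈ M.feasible x, Real.exp (M.hamiltonian v t x S / M.temp) =
      Real.exp (M.rate * M.meanAfter (v t) x S / M.temp) *
        Real.exp (-(M.rate * v t x / M.temp)) := fun S hS => by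
    rw [hamiltonian_eq hS, ← Real.exp_add]
    congr 1
    ring
  have hpos : 0 < ∑ S ∈ M.feasible x, Real.exp (M.rate * M.meanAfter (v t) x S / M.temp) :=
    Finset.sum_pos (fun _ _ => Real.exp_pos _) ⟨∅, empty_mem_feasible x⟩
  rw [freeEnergy, Finset.sum_congr rfl h, ← Finset.sum_mul,
    Real.log_mul hpos.ne' (Real.exp_pos _).ne', Real.log_exp, softmaxNext]
  field_simp
  ring

/-- `meanAfter` is an average, hence does not expand the supremum distance. -/
theorem meanAfter_le_add (u u' : M.State → ℝ) (x : M.State) (S : Finset (Fin n)) :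
    M.meanAfter u x S ≤ M.meanAfter u' x S + dist u u' := by
  have h : ∀ y, u y ≤ u' y + dist u u' := fun y => by
    have := (le_abs_self _).trans ((Real.dist_eq (u y) (u' y)).symm.le.trans
      (dist_le_pi_dist u u' y))
    linarith
  calc M.meanAfter u x S
      ≤ ∑ o, (M.choiceProb S o * (M.revenue o + u' (M.sell x o)) +
          M.choiceProb S o * dist u u') := Finset.sum_le_sum fun o _ => by
        rw [← mul_add]
        exact mul_le_mul_of_nonneg_left (by linarith [h (M.sell x o)]) (M.choiceProb_nonneg S o)
    _ = _ := by rw [Finset.sum_add_distrib, ← Finset.sum_mul, M.choiceProb_sum, one_mul]; rfl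

theorem softmaxNext_le_add (u u' : M.State → ℝ) (x : M.State) :
    M.softmaxNext u x ≤ M.softmaxNext u' x + M.rate * dist u u' := by
  have hγ := M.temp_pos
  have hpos : ∀ u, 0 < ∑ S ∈ M.feasible x, Real.exp (M.rate * M.meanAfter u x S / M.temp) :=
    fun u => Finset.sum_pos (fun _ _ => Real.exp_pos _) ⟨∅, empty_mem_feasible x⟩
  have h : ∑ S ∈ M.feasible x, Real.exp (M.rate * M.meanAfter u x S / M.temp) ≤
      (∑ S ∈ M.feasible x, Real.exp (M.rate * M.meanAfter u' x S / M.temp)) *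
        Real.exp (M.rate * dist u u' / M.temp) := by
    rw [Finset.sum_mul]
    refine Finset.sum_le_sum fun S _ => ?_
    rw [← Real.exp_add, Real.exp_le_exp, ← add_div, ← mul_add]
    have := M.rate_pos.le
    gcongr
    exact meanAfter_le_add u u' x S
  have hlog := Real.log_le_log (hpos u) h
  rw [Real.log_mul (hpos u').ne' (Real.exp_pos _).ne', Real.log_exp] at hlog
  calc M.softmaxNext u x
      ≤ M.temp * (Real.log (∑ S ∈ M.feasible x, Real.exp (M.rate * M.meanAfter u' x S / M.temp)) +
          M.rate * dist u u' / M.temp) := mul_le_mul_of_nonneg_left hlog hγ.le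
    _ = _ := by rw [softmaxNext]; field_simp

theorem abs_softmaxNext_sub_le (u u' : M.State → ℝ) (x : M.State) :
    |M.softmaxNext u x - M.softmaxNext u' x| ≤ M.rate * dist u u' := by
  have h1 := softmaxNext_le_add u u' x
  have h2 := softmaxNext_le_add u' u x
  rw [dist_comm u' u] at h2
  exact abs_le.2 ⟨by linarith, by linarith⟩

theorem continuous_softmaxNext (x : M.State) : Continuous fun u => M.softmaxNext u x := by
  unfold softmaxNext meanAfter
  refine continuous_const.mul (Continuous.log (by fun_prop) fun u => ?_)
  exact (Finset.sum_pos (fun _ _ => Real.exp_pos _) ⟨∅, empty_mem_feasible x⟩).ne'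

/-- The Picard operator of the HJB equation in discounted form,
`u ↦ ∫_t^T e^{-λ (s - t)} softmaxNext (u s) ds`. -/
def picard (M : NRM m n) (u : ℝ → M.State → ℝ) (t : ℝ) (x : M.State) : ℝ :=
  Real.exp (M.rate * t) * ∫ s in t..M.T, Real.exp (-(M.rate * s)) * M.softmaxNext (u s) x

section picard

variable {u u' : ℝ → M.State → ℝ}

theorem continuous_picard_integrand (hu : Continuous u) (x : M.State) :
    Continuous fun s => Real.exp (-(M.rate * s)) * M.softmaxNext (u s) x :=
  Continuous.mul (by fun_prop) ((continuous_softmaxNext x).comp hu)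

theorem hasDerivAt_picard (hu : Continuous u) (t : ℝ) (x : M.State) :
    HasDerivAt (fun t => M.picard u t x) (M.rate * M.picard u t x - M.softmaxNext (u t) x) t := by
  have hc := continuous_picard_integrand hu x
  have h1 : HasDerivAt (fun t => Real.exp (M.rate * t)) (Real.exp (M.rate * t) * (M.rate * 1)) t :=
    ((hasDerivAt_id t).const_mul M.rate).exp
  have h2 := intervalIntegral.integral_hasDerivAt_left (hc.intervalIntegrable t M.T)
    (hc.stronglyMeasurableAtFilter _ _) hc.continuousAt
  refine (h1.mul h2).congr_deriv ?_
  have h3 : Real.exp (M.rate * t) * Real.exp (-(M.rate * t)) = 1 := by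
    rw [← Real.exp_add, add_neg_cancel, Real.exp_zero]
  rw [picard]
  linear_combination (-M.softmaxNext (u t) x) * h3

theorem continuous_picard (hu : Continuous u) : Continuous fun t => M.picard u t :=
  continuous_pi fun x => continuous_iff_continuousAt.2 fun t =>
    (hasDerivAt_picard hu t x).continuousAt

theorem abs_picard_sub_le (hu : Continuous u) (hu' : Continuous u') {D : ℝ}
    (hD : ∀ s ∈ Icc 0 M.T, dist (u s) (u' s) ≤ D) {t : ℝ} (ht : t ∈ Icc 0 M.T) (x : M.State) :
    |M.picard u t x - M.picard u' t x| ≤ (1 - Real.exp (-(M.rate * M.T))) * D := by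
  have hD0 : 0 ≤ D := dist_nonneg.trans (hD t ht)
  have hc := continuous_picard_integrand hu x
  have hc' := continuous_picard_integrand hu' x
  have hbd : ∀ s ∈ Ioc t M.T, ‖Real.exp (-(M.rate * s)) * M.softmaxNext (u s) x -
      Real.exp (-(M.rate * s)) * M.softmaxNext (u' s) x‖ ≤
        M.rate * Real.exp (-(M.rate * s)) * D := fun s hs => by
    rw [← mul_sub, Real.norm_eq_abs, abs_mul, Real.abs_exp]
    calc _ ≤ Real.exp (-(M.rate * s)) * (M.rate * D) := by
          refine mul_le_mul_of_nonneg_left ((abs_softmaxNext_sub_le _ _ x).trans ?_)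
            (Real.exp_pos _).le
          exact mul_le_mul_of_nonneg_left (hD s ⟨ht.1.trans hs.1.le, hs.2⟩) M.rate_pos.le
      _ = _ := by ring
  have hI : ∫ s in t..M.T, M.rate * Real.exp (-(M.rate * s)) * D =
      (Real.exp (-(M.rate * t)) - Real.exp (-(M.rate * M.T))) * D := by
    rw [intervalIntegral.integral_mul_const, intervalIntegral.integral_eq_sub_of_hasDerivAt
      (fun s _ => hasDerivAt_neg_exp_mul_exp) (Continuous.intervalIntegrable (by fun_prop) _ _)]
    ring
  have h1 : ‖∫ s in t..M.T, (Real.exp (-(M.rate * s)) * M.softmaxNext (u s) x -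
      Real.exp (-(M.rate * s)) * M.softmaxNext (u' s) x)‖ ≤
        (Real.exp (-(M.rate * t)) - Real.exp (-(M.rate * M.T))) * D := by
    rw [← hI]
    exact intervalIntegral.norm_integral_le_of_norm_le ht.2
      (Filter.Eventually.of_forall hbd) (Continuous.intervalIntegrable (by fun_prop) _ _)
  rw [picard, picard, ← mul_sub, ← intervalIntegral.integral_sub (hc.intervalIntegrable _ _)
    (hc'.intervalIntegrable _ _), abs_mul, Real.abs_exp]
  refine (mul_le_mul_of_nonneg_left h1 (Real.exp_pos _).le).trans ?_
  rw [← mul_assoc, mul_sub, ← Real.exp_add, ← Real.exp_add, add_neg_cancel, Real.exp_zero]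
  refine mul_le_mul_of_nonneg_right (sub_le_sub_left (Real.exp_le_exp.2 ?_) 1) hD0
  linarith [mul_nonneg M.rate_pos.le ht.1]

end picard

/-- The Picard operator is a contraction with factor `1 - exp (-λ T)` for the supremum norm over the
whole horizon, so that its fixed point is a global solution. -/
theorem exists_solvesHJB (M : NRM m n) : ∃ v, M.IsC10 v ∧ M.SolvesHJB v := by
  -- Functions on `[0, T]` are extended to all times by their boundary values.
  let ext (u : C(Icc 0 M.T, M.State → ℝ)) (t : ℝ) : M.State → ℝ := u (projIcc 0 M.T M.T_pos.le t)
  have hext : ∀ u, Continuous (ext u) := fun u => u.continuous.comp continuous_projIcc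
  let Φ (u : C(Icc 0 M.T, M.State → ℝ)) : C(Icc 0 M.T, M.State → ℝ) :=
    ⟨fun t => M.picard (ext u) t, (continuous_picard (hext u)).comp continuous_subtype_val⟩
  have hq : 0 ≤ 1 - Real.exp (-(M.rate * M.T)) := sub_nonneg.2
    (Real.exp_le_one_iff.2 (neg_nonpos.2 (mul_nonneg M.rate_pos.le M.T_pos.le)))
  have hΦ : ContractingWith (1 - Real.exp (-(M.rate * M.T))).toNNReal Φ := by
    refine ⟨Real.toNNReal_lt_one.2 (by linarith [Real.exp_pos (-(M.rate * M.T))]),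
      LipschitzWith.of_dist_le_mul fun u u' => ?_⟩
    rw [Real.coe_toNNReal _ hq, ContinuousMap.dist_le (mul_nonneg hq dist_nonneg)]
    intro t
    rw [dist_pi_le_iff (mul_nonneg hq dist_nonneg)]
    intro x
    rw [Real.dist_eq]
    exact abs_picard_sub_le (hext u) (hext u')
      (fun s _ => ContinuousMap.dist_apply_le_dist _) t.2 x
  obtain ⟨u, hu⟩ : ∃ u, Φ u = u := ⟨hΦ.fixedPoint Φ, hΦ.fixedPoint_isFixedPt⟩
  have hfix : ∀ t ∈ Icc 0 M.T, ext u t = M.picard (ext u) t := fun t ht => by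
    have h1 : ext u t = u ⟨t, ht⟩ := by simp only [ext, projIcc_of_mem M.T_pos.le ht]
    rw [h1]
    conv_lhs => rw [← hu]
    rfl
  have hcd : M.IsC10 (M.picard (ext u)) := fun x => by
    have hd := fun t => hasDerivAt_picard (hext u) t x
    refine ContDiff.contDiffOn (contDiff_one_iff_deriv.2 ⟨fun t => (hd t).differentiableAt, ?_⟩)
    rw [funext fun t => (hd t).deriv]
    exact (continuous_const.mul ((continuous_apply x).comp (continuous_picard (hext u)))).sub
      ((continuous_softmaxNext x).comp (hext u))
  refine ⟨M.picard (ext u), hcd, ⟨fun t ht x => ?_, fun x => ?_⟩⟩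
  · have ht' := Ico_subset_Icc_self ht
    rw [(hasDerivAt_picard (hext u) t x).hasDerivWithinAt.derivWithin
      (uniqueDiffOn_Icc M.T_pos t ht'), hfix t ht', neg_sub, ← freeEnergy_eq_softmaxNext]
    exact (isGreatest_freeEnergy (fun x => (hcd x).continuousOn) ht' x).isLUB
  · simp [picard]

end NRM

end

theorem mainTheorem6 {m n : ℕ} (M : NRM m n) :
    -- `J*` is a genuine supremum of genuine expectations
    (∀ π, M.IsAdmissible π → ∀ t ∈ Icc 0 M.T, ∀ x, Integrable (M.reward π t x) M.law) ∧
    (∀ t ∈ Icc 0 M.T, ∀ x,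
      IsLUB {a : ℝ | ∃ π, M.IsAdmissible π ∧ a = M.value π t x} (M.optValue t x)) ∧
    -- the exploratory HJB equation has a `C^{1,0}` solution, and every such solution is `J*`
    (∃ v, M.IsC10 v ∧ M.SolvesHJB v) ∧
    (∀ v, M.IsC10 v → M.SolvesHJB v → ∀ t ∈ Icc 0 M.T, ∀ x, v t x = M.optValue t x) ∧
    -- the Boltzmann policy is optimal, and it is the only optimal policy
    M.IsOptimal (M.boltzmann M.optValue) ∧
    (∀ π, M.IsOptimal π → ∀ t ∈ Icc 0 M.T, ∀ x S, π t x S = M.boltzmann M.optValue t x S) := by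
  obtain ⟨v, hv, hs⟩ := M.exists_solvesHJB
  have hw := hs.isClassicalSolution hv
  have hopt : ∀ t ∈ Icc 0 M.T, v (M.clamp t) = M.optValue t := fun t ht =>
    funext fun x => hw.eq_optValue ht x
  have hbol : ∀ t ∈ Icc 0 M.T, M.boltzmann M.optValue t = M.boltzmann (fun t => v (M.clamp t)) t :=
    fun t ht => NRM.boltzmann_congr (hopt t ht).symm
  refine ⟨fun π hπ t ht x => ?_, fun t ht x => ?_, ⟨v, hv, hs⟩, fun v' hv' hs' t ht x => ?_,
    ⟨NRM.isAdmissible_boltzmann fun x => ?_, fun t ht x => ?_⟩, fun π hπ t ht x S => ?_⟩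
  · rw [NRM.reward_congr (NRM.eq_comp_clamp π) ht]
    exact hπ.isRegular_clamp.integrable_reward ht x
  · rw [← hopt t ht]
    exact (hw.isGreatest_value ht x).isLUB
  · rw [← (hs'.isClassicalSolution hv').eq_optValue ht x, NRM.clamp_of_mem ht]
  · exact (hw.continuous x).continuousOn.congr fun t ht => by rw [← hopt t ht]
  · rw [NRM.value_congr hbol ht, hw.value_boltzmann t ht x, hopt t ht]
  · rw [hbol t ht, ← hw.eq_boltzmann_of_value_eq hπ.1.isRegular_clamp (fun t ht x => ?_) t ht x S,
      NRM.clamp_of_mem ht]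
    rw [← NRM.value_congr (NRM.eq_comp_clamp π) ht, hπ.2 t ht x, hopt t ht]
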